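/- Let $G$ be a second countable, locally compact, Hausdorff, unimodular group with Haar measure $dx$, let $N\subseteq G$ be a closed subgroup, and let $\phi:G\times G\times G\to\mathbb T$ be a continuous antisymmetric tricharacter: it is multiplicative in each variable, interchanging two variables inverts it, and $\phi=1$ whenever two arguments coincide. Let $A$ be a $C^*$-algebra with multiplier algebra $M(A)$, let $\alpha_r$ ($r\in N$) be $*$-automorphisms of $A$, and let $u:G\times G\to UM(A)$ be a strictly continuous map into the unitary multipliers with $u(1,x)=u(x,1)=1$ such that, for $r,s,t\in N$ and $x,y\in G$, $$\alpha_s\alpha_t=\mathrm{ad}(u(s,t))\,\alpha_{st},\qquad \alpha_r[u(x,y)]\,u(r,xy)=\phi(r,x,y)\,u(r,x)\,u(rx,y).$$ Let $B=u\text{-}\mathrm{ind}_N^G(A)$ be the $C^*$-algebra, with pointwise operations and supremum norm, of the continuous functions $f:G\to A$ such that $f(rx)=\mathrm{ad}(u(r,x))^{-1}\alpha_r[f(x)]$ for $r\in N$, $x\in G$, and such that $\|f(\cdot)\|$ vanishes at infinity on $N\backslash G$. Let $\beta_y[f](x)=\mathrm{ad}(u(x,y))[f(xy)]$, an automorphism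 of $B$, and let $v(y,z)$ be the unitary multiplier of $B$ given by multiplication by $x\mapsto\phi(x,y,z)u(x,y)u(xy,z)u(x,yz)^{-1}$. On the space $C_c(G,B)$ of continuous compactly supported functions put $$(F_1*F_2)(x)=\int_G F_1(y)\,\beta_y[F_2(y^{-1}x)]\,v(y,y^{-1}x)\,dy,\qquad F^*(x)=v(x,x^{-1})^{-1}\beta_x[F(x^{-1})]^*,$$ and $\|F\|_2=\|(F^**F)(1)\|^{1/2}$, $\|F\|=\sup\{\|F*F'\|_2:\ F'\in C_c(G,B),\ \|F'\|_2\le1\}$ (the norm given by the left regular representation). The twisted crossed product $B\rtimes_{\beta,v}G$ is the completion of $C_c(G,B)$ in this norm. Let $\mathcal K$ be the space of continuous kernels $K:G\times G\to A$ such that $$K(rz,rw)=\phi(r,z,w)^{-1}u(r,z)^{-1}\alpha_r[K(z,w)]\,u(r,w)\qquad(r\in N,\ z,w\in G),$$ such that there is a compact $C\subseteq G$ with $K(z,w)=0$ unless $z^{-1}w\in C$, and such that for every $\varepsilon>0$ there is a compact $C'\subseteq G$ with $\|K(z,w)\|<\varepsilon$ unless $z\in NC'$. Put $$(K_1\star K_2)(z,w)=\int_G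 K_1(z,v)K_2(v,w)\,\phi(z,v,w)\,dv,\qquad K^*(z,w)=K(w,z)^*,$$ and $\|K\|_2=\sup_z\|(K^*\star K)(z,z)\|^{1/2}$, $\|K\|=\sup\{\|K\star K'\|_2:\ K'\in\mathcal K,\ \|K'\|_2\le1\}$. Then $C_c(G,B)$ and $\mathcal K$ are (in general nonassociative) complex $*$-algebras with these operations; $\|\cdot\|$ is a (finite) norm on $C_c(G,B)$ for which the involution is isometric; and there is a linear bijection $\Phi:C_c(G,B)\to\mathcal K$ with $$\Phi(F_1*F_2)=\Phi(F_1)\star\Phi(F_2),\qquad \Phi(F^*)=\Phi(F)^*,\qquad \|\Phi(F)\|=\|F\|.$$ Consequently $\Phi$ extends to an isometric linear isomorphism from $B\rtimes_{\beta,v}G$ onto the completion of $\mathcal K$, which preserves the involution and the product; here, in the completions, $c$ is a product of $a$ and $b$ if $(a,b,c)$ is a limit of triples $(a_n,b_n,a_nb_n)$ with $a_n,b_n$ in the dense $*$-algebra, and the adjoint is extended by limits in the same way. -/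

import Mathlib

open Topology MeasureTheory
open scoped MultiplierAlgebra BoundedContinuousFunction ENNReal

noncomputable section
namespace TwistedInduction

/-- The product `m a ∈ A` of a multiplier `m` and `a ∈ A`. -/
def lmul {A : Type*} [NonUnitalCStarAlgebra A] (m : 𝓜(ℂ, A)) (a : A) : A := m.fst a

/-- The product `a m ∈ A` of `a ∈ A` and a multiplier `m`. -/
def rmul {A : Type*} [NonUnitalCStarAlgebra A] (a : A) (m : 𝓜(ℂ, A)) : A := m.snd a

local infixr:72 " ▷ " => lmul
local infixl:72 " ◁ " => rmul

section Multipliers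

variable {A : Type*} [NonUnitalCStarAlgebra A]

theorem mult_ext {m n : 𝓜(ℂ, A)} (h : ∀ a, m ▷ a = n ▷ a) (h' : ∀ a, a ◁ m = a ◁ n) : m = n :=
  DoubleCentralizer.ext _ _ _ _ (Prod.ext (ContinuousLinearMap.ext h) (ContinuousLinearMap.ext h'))

theorem eq_of_mul_right {a b : A} (h : ∀ c, a * c = b * c) : a = b := by
  rw [← sub_eq_zero, ← CStarRing.mul_star_self_eq_zero_iff, sub_mul, h, sub_self]

theorem eq_of_mul_left {a b : A} (h : ∀ c, c * a = c * b) : a = b := by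
  rw [← sub_eq_zero, ← CStarRing.star_mul_self_eq_zero_iff, mul_sub, h, sub_self]

theorem rmul_mul (a : A) (m : 𝓜(ℂ, A)) (b : A) : (a ◁ m) * b = a * (m ▷ b) := m.central a b

theorem lmul_mul (m : 𝓜(ℂ, A)) (a b : A) : m ▷ (a * b) = (m ▷ a) * b :=
  eq_of_mul_left fun c => by
    rw [← rmul_mul, ← mul_assoc, ← mul_assoc, rmul_mul]

theorem mul_rmul (a b : A) (m : 𝓜(ℂ, A)) : (a * b) ◁ m = a * (b ◁ m) :=
  eq_of_mul_right fun c => by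
    rw [rmul_mul, mul_assoc, mul_assoc, rmul_mul]

/-- The embedding of `A` into its multiplier algebra. -/
def emb (a : A) : 𝓜(ℂ, A) := DoubleCentralizer.coeHom a

theorem emb_mul (a b : A) : emb (a * b) = emb a * emb b := map_mul _ _ _

theorem emb_star (a : A) : emb (star a) = star (emb a) := map_star _ _

theorem emb_injective : Function.Injective (emb : A → 𝓜(ℂ, A)) := fun _ _ h =>
  eq_of_mul_right fun c => congrArg (fun m : 𝓜(ℂ, A) => m ▷ c) h

theorem emb_lmul (m : 𝓜(ℂ, A)) (a : A) : emb (m ▷ a) = m * emb a :=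
  mult_ext (fun b => (lmul_mul m a b).symm) (fun b => (rmul_mul b m a).symm)

theorem emb_rmul (m : 𝓜(ℂ, A)) (a : A) : emb (a ◁ m) = emb a * m :=
  mult_ext (fun b => rmul_mul a m b) (fun b => (mul_rmul b a m).symm)

theorem inv_mul_coe (w : unitary 𝓜(ℂ, A)) : (↑w⁻¹ : 𝓜(ℂ, A)) * ↑w = 1 :=
  Unitary.coe_star_mul_self w

theorem coe_mul_inv (w : unitary 𝓜(ℂ, A)) : (↑w : 𝓜(ℂ, A)) * ↑w⁻¹ = 1 :=
  Unitary.coe_mul_star_self w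

theorem inv_mul_cancel_coe (w : unitary 𝓜(ℂ, A)) (m : 𝓜(ℂ, A)) : ↑w⁻¹ * (↑w * m) = m := by
  rw [← mul_assoc, inv_mul_coe, one_mul]

theorem mul_inv_cancel_coe (w : unitary 𝓜(ℂ, A)) (m : 𝓜(ℂ, A)) : ↑w * (↑w⁻¹ * m) = m := by
  rw [← mul_assoc, coe_mul_inv, one_mul]

theorem star_coe (w : unitary 𝓜(ℂ, A)) : star (w : 𝓜(ℂ, A)) = ↑w⁻¹ := rfl

/-- The inner automorphism `ad(w) : a ↦ w a w⁻¹` of `A` given by a unitary multiplier `w`. -/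
def ad (w : unitary 𝓜(ℂ, A)) : A ≃⋆ₐ[ℂ] A where
  toFun a := ((w : 𝓜(ℂ, A)) ▷ a) ◁ (↑w⁻¹ : 𝓜(ℂ, A))
  invFun a := ((↑w⁻¹ : 𝓜(ℂ, A)) ▷ a) ◁ (w : 𝓜(ℂ, A))
  left_inv a := emb_injective (by
    simp only [emb_rmul, emb_lmul, mul_assoc, inv_mul_coe, inv_mul_cancel_coe, mul_one])
  right_inv a := emb_injective (by
    simp only [emb_rmul, emb_lmul, mul_assoc, coe_mul_inv, mul_inv_cancel_coe, mul_one])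
  map_mul' a b := emb_injective (by
    simp only [emb_rmul, emb_lmul, emb_mul, mul_assoc, inv_mul_cancel_coe])
  map_add' a b := by simp [lmul, rmul]
  map_smul' c a := by simp [lmul, rmul]
  map_star' a := emb_injective (by
    simp only [emb_rmul, emb_lmul, emb_star, star_mul, star_coe, inv_inv, mul_assoc])

theorem ad_apply (w : unitary 𝓜(ℂ, A)) (a : A) :
    ad w a = ((w : 𝓜(ℂ, A)) ▷ a) ◁ (↑w⁻¹ : 𝓜(ℂ, A)) := rfl

theorem emb_ad (w : unitary 𝓜(ℂ, A)) (a : A) : emb (ad w a) = w * (emb a * ↑w⁻¹) := by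
  rw [ad_apply, emb_rmul, emb_lmul, mul_assoc]

theorem ad_mul (w w' : unitary 𝓜(ℂ, A)) (a : A) : ad (w * w') a = ad w (ad w' a) :=
  emb_injective (by
    simp only [emb_ad, mul_inv_rev, Submonoid.coe_mul, mul_assoc])

theorem ad_one (a : A) : ad (1 : unitary 𝓜(ℂ, A)) a = a :=
  emb_injective (by simp [emb_ad])

/-- An automorphism as a continuous linear map. -/
def autL (α : A ≃⋆ₐ[ℂ] A) : A →L[ℂ] A where
  toFun := α
  map_add' := map_add α
  map_smul' := map_smul α
  cont := (StarAlgEquiv.isometry α).continuous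

/-- The extension of an automorphism `α` of `A` to the multiplier algebra,
`α(m) a = α(m α⁻¹(a))` and `a α(m) = α(α⁻¹(a) m)`. -/
def extend (α : A ≃⋆ₐ[ℂ] A) : 𝓜(ℂ, A) →⋆ₐ[ℂ] 𝓜(ℂ, A) where
  toFun m :=
    { fst := (autL α).comp (m.fst.comp (autL α.symm))
      snd := (autL α).comp (m.snd.comp (autL α.symm))
      central := fun a b => by
        have h := m.central (α.symm a) (α.symm b)
        have h' := congrArg α h
        rw [map_mul, map_mul] at h'
        simpa [autL] using h' }
  map_one' := mult_ext (fun a => α.apply_symm_apply a) (fun a => α.apply_symm_apply a)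
  map_mul' m n := mult_ext
    (fun a => congrArg (fun x => α (m.fst x)) (α.symm_apply_apply (n.fst (α.symm a))).symm)
    (fun a => congrArg (fun x => α (n.snd x)) (α.symm_apply_apply (m.snd (α.symm a))).symm)
  map_zero' := mult_ext (fun a => map_zero α) (fun a => map_zero α)
  map_add' m n := mult_ext (fun a => map_add α _ _) (fun a => map_add α _ _)
  commutes' c := mult_ext
    (fun a => by
      change α ((algebraMap ℂ 𝓜(ℂ, A) c).fst (α.symm a)) = (algebraMap ℂ 𝓜(ℂ, A) c).fst a
      simp [Algebra.algebraMap_eq_smul_one])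
    (fun a => by
      change α ((algebraMap ℂ 𝓜(ℂ, A) c).snd (α.symm a)) = (algebraMap ℂ 𝓜(ℂ, A) c).snd a
      simp [Algebra.algebraMap_eq_smul_one])
  map_star' m := mult_ext
    (fun a => by
      change α (star (m.snd (star (α.symm a)))) = star (α (m.snd (α.symm (star a))))
      rw [map_star α.symm, map_star α])
    (fun a => by
      change α (star (m.fst (star (α.symm a)))) = star (α (m.fst (α.symm (star a))))
      rw [map_star α.symm, map_star α])

theorem extend_emb (α : A ≃⋆ₐ[ℂ] A) (a : A) : extend α (emb a) = emb (α a) :=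
  mult_ext
    (fun b => by
      change α (a * α.symm b) = α a * b
      rw [map_mul, α.apply_symm_apply])
    (fun b => by
      change α (α.symm b * a) = b * α a
      rw [map_mul, α.apply_symm_apply])

theorem lmul_extend (α : A ≃⋆ₐ[ℂ] A) (m : 𝓜(ℂ, A)) (a : A) : α (m ▷ a) = extend α m ▷ α a :=
  emb_injective (by rw [← extend_emb, emb_lmul, emb_lmul, map_mul, extend_emb])

theorem rmul_extend (α : A ≃⋆ₐ[ℂ] A) (m : 𝓜(ℂ, A)) (a : A) : α (a ◁ m) = α a ◁ extend α m :=
  emb_injective (by rw [← extend_emb, emb_rmul, emb_rmul, map_mul, extend_emb])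


theorem norm_unitary_lmul (w : unitary 𝓜(ℂ, A)) (a : A) : ‖(w : 𝓜(ℂ, A)) ▷ a‖ = ‖a‖ := by
  have h : star ((w : 𝓜(ℂ, A)) ▷ a) * ((w : 𝓜(ℂ, A)) ▷ a) = star a * a := emb_injective (by
    simp only [emb_mul, emb_star, emb_lmul, star_mul, star_coe, mul_assoc, inv_mul_cancel_coe])
  have h' := congrArg norm h
  rw [CStarRing.norm_star_mul_self, CStarRing.norm_star_mul_self] at h'
  exact (mul_self_inj (norm_nonneg _) (norm_nonneg _)).1 h'

theorem star_rmul_unitary (w : unitary 𝓜(ℂ, A)) (a : A) :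
    a ◁ (w : 𝓜(ℂ, A)) = star ((↑w⁻¹ : 𝓜(ℂ, A)) ▷ star a) := emb_injective (by
  simp only [emb_star, emb_lmul, emb_rmul, star_mul, star_star, star_coe, inv_inv])

theorem norm_unitary_rmul (w : unitary 𝓜(ℂ, A)) (a : A) : ‖a ◁ (w : 𝓜(ℂ, A))‖ = ‖a‖ := by
  rw [star_rmul_unitary, norm_star, norm_unitary_lmul, norm_star]

/-- Strict continuity of a family of multipliers. -/
def StrictlyContinuous {X : Type*} [TopologicalSpace X] (m : X → 𝓜(ℂ, A)) : Prop :=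
  ∀ a : A, Continuous (fun x => m x ▷ a) ∧ Continuous (fun x => a ◁ m x)

theorem StrictlyContinuous.inv {X : Type*} [TopologicalSpace X] {w : X → unitary 𝓜(ℂ, A)}
    (h : StrictlyContinuous fun x => (w x : 𝓜(ℂ, A))) :
    StrictlyContinuous fun x => ((w x)⁻¹ : unitary 𝓜(ℂ, A)).1 := fun a =>
  ⟨(continuous_star.comp (h (star a)).2).congr fun x => by
      simp only [Function.comp, star_rmul_unitary, star_star],
    (continuous_star.comp (h (star a)).1).congr fun x => by
      simp only [Function.comp, star_rmul_unitary, inv_inv]⟩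

theorem StrictlyContinuous.lmul {X : Type*} [TopologicalSpace X] {w : X → unitary 𝓜(ℂ, A)}
    (h : StrictlyContinuous fun x => (w x : 𝓜(ℂ, A))) {f : X → A} (hf : Continuous f) :
    Continuous fun x => (w x : 𝓜(ℂ, A)) ▷ f x := by
  rw [continuous_iff_continuousAt]
  intro x₀
  have h1 : Filter.Tendsto (fun x => (w x : 𝓜(ℂ, A)) ▷ (f x - f x₀)) (𝓝 x₀) (𝓝 0) := by
    rw [tendsto_zero_iff_norm_tendsto_zero]
    simp only [norm_unitary_lmul]
    have h3 : Continuous fun x => ‖f x - f x₀‖ := by fun_prop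
    simpa using h3.tendsto x₀
  have h2 := ((h (f x₀)).1.tendsto x₀).add h1
  refine (h2.congr fun x => ?_).trans (by simp)
  simp [TwistedInduction.lmul]

theorem StrictlyContinuous.rmul {X : Type*} [TopologicalSpace X] {w : X → unitary 𝓜(ℂ, A)}
    (h : StrictlyContinuous fun x => (w x : 𝓜(ℂ, A))) {f : X → A} (hf : Continuous f) :
    Continuous fun x => f x ◁ (w x : 𝓜(ℂ, A)) :=
  (continuous_star.comp (h.inv.lmul (continuous_star.comp hf))).congr fun x => by
    simp only [Function.comp, star_rmul_unitary]

theorem StrictlyContinuous.ad {X : Type*} [TopologicalSpace X] {w : X → unitary 𝓜(ℂ, A)}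
    (h : StrictlyContinuous fun x => (w x : 𝓜(ℂ, A))) {f : X → A} (hf : Continuous f) :
    Continuous fun x => ad (w x) (f x) :=
  h.inv.rmul (h.lmul hf)

/-- A complex number of modulus one as a (central) unitary multiplier. -/
def scal (c : Circle) : unitary 𝓜(ℂ, A) :=
  ⟨algebraMap ℂ 𝓜(ℂ, A) c, by
    have h : star (c : ℂ) * c = 1 := by
      simp [← Complex.normSq_eq_conj_mul_self]
    rw [Unitary.mem_iff, ← algebraMap_star_comm, ← map_mul, ← map_mul, mul_comm (c : ℂ), h, map_one]
    exact ⟨rfl, rfl⟩⟩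

theorem scal_mul (c d : Circle) : (scal (c * d) : unitary 𝓜(ℂ, A)) = scal c * scal d :=
  Subtype.ext (by simp [scal])

theorem scal_one : (scal 1 : unitary 𝓜(ℂ, A)) = 1 :=
  Subtype.ext (by simp [scal])

theorem scal_comm (c : Circle) (m : 𝓜(ℂ, A)) :
    (scal c : unitary 𝓜(ℂ, A)).1 * m = m * (scal c : unitary 𝓜(ℂ, A)).1 :=
  Algebra.commutes _ _

theorem scal_lmul (c : Circle) (a : A) : (scal c : unitary 𝓜(ℂ, A)).1 ▷ a = (c : ℂ) • a := by
  simp [scal, lmul, Algebra.algebraMap_eq_smul_one]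

theorem extend_scal (α : A ≃⋆ₐ[ℂ] A) (c : Circle) :
    extend α (scal c : unitary 𝓜(ℂ, A)).1 = (scal c : unitary 𝓜(ℂ, A)).1 :=
  (extend α).commutes _

/-- The extension of an automorphism to the unitary group of the multiplier algebra. -/
def extendU (α : A ≃⋆ₐ[ℂ] A) (w : unitary 𝓜(ℂ, A)) : unitary 𝓜(ℂ, A) :=
  ⟨extend α w, Unitary.map_mem (extend α) w.2⟩

theorem ad_aut (α : A ≃⋆ₐ[ℂ] A) (w : unitary 𝓜(ℂ, A)) (a : A) :
    α (ad w a) = ad (extendU α w) (α a) := by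
  rw [ad_apply, rmul_extend, lmul_extend]
  have : extend α (↑w⁻¹ : 𝓜(ℂ, A)) = (↑(extendU α w)⁻¹ : 𝓜(ℂ, A)) := map_star (extend α) _
  rw [this]
  rfl

end Multipliers

section Systems

variable {G : Type*} [Group G] [TopologicalSpace G]

/-- A continuous antisymmetric (alternating) tricharacter `φ : G × G × G → 𝕋`. -/
structure Tricharacter (G : Type*) [Group G] [TopologicalSpace G] where
  toFun : G → G → G → Circle
  continuous' : Continuous fun p : G × G × G => toFun p.1 p.2.1 p.2.2
  mul_left : ∀ x x' y z, toFun (x * x') y z = toFun x y z * toFun x' y z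
  mul_mid : ∀ x y y' z, toFun x (y * y') z = toFun x y z * toFun x y' z
  mul_right : ∀ x y z z', toFun x y (z * z') = toFun x y z * toFun x y z'
  swap_left : ∀ x y z, toFun y x z = (toFun x y z)⁻¹
  swap_right : ∀ x y z, toFun x z y = (toFun x y z)⁻¹
  diag : ∀ x z, toFun x x z = 1

instance : CoeFun (Tricharacter G) (fun _ => G → G → G → Circle) := ⟨Tricharacter.toFun⟩

/-- The data for twisted induction from `N` to `G`: automorphisms `α_r` (`r ∈ N`) of `A` and
unitary multipliers `u(x, y)` (`x, y ∈ G`) of `A` with `α_s α_t = ad(u(s,t)) α_{st}` on `N` and with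
the cocycle identity modified by the tricharacter `φ`. -/
structure TwistedSystem (φ : Tricharacter G) (N : Subgroup G) (A : Type*)
    [NonUnitalCStarAlgebra A] where
  α : N → A ≃⋆ₐ[ℂ] A
  u : G → G → unitary 𝓜(ℂ, A)
  u_continuous : StrictlyContinuous fun p : G × G => (u p.1 p.2 : 𝓜(ℂ, A))
  u_one_left : ∀ x, u 1 x = 1
  u_one_right : ∀ x, u x 1 = 1
  α_mul : ∀ (s t : N) (a : A), α s (α t a) = ad (u s t) (α (s * t) a)
  cocycle : ∀ (r : N) (x y : G), extend (α r) (u x y) * (u r (x * y) : 𝓜(ℂ, A)) =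
    (φ r x y : ℂ) • ((u r x : 𝓜(ℂ, A)) * (u (r * x) y : 𝓜(ℂ, A)))

/-- A function on `X` with a map to `G` vanishes at infinity in the `G`-direction modulo `N`:
for every `ε > 0` it is smaller than `ε` off the preimage of `N C` for some compact `C ⊆ G`. -/
def VanishesModulo (N : Subgroup G) {X E : Type*} [Norm E] (π : X → G) (f : X → E) : Prop :=
  ∀ ε > 0, ∃ C : Set G, IsCompact C ∧ ∀ x, ε ≤ ‖f x‖ → ∃ r ∈ N, ∃ c ∈ C, π x = r * c

variable {φ : Tricharacter G} {N : Subgroup G} {A : Type*} [NonUnitalCStarAlgebra A]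

/-- The twisted induced algebra `u-ind_N^G(A)`: continuous `f : G → A` with
`f(rx) = ad(u(r,x))⁻¹ α_r[f(x)]` for `r ∈ N`, such that `‖f‖` (which is a function on `N \ G`)
vanishes at infinity on `N \ G`; with pointwise operations and the supremum norm. -/
def induced (D : TwistedSystem φ N A) : NonUnitalStarSubalgebra ℂ (G →ᵇ A) where
  carrier := {f | (∀ (r : N) (x : G), f (r * x) = ad (D.u r x)⁻¹ (D.α r (f x))) ∧
    VanishesModulo N id f}
  zero_mem' := ⟨fun r x => by simp, fun ε hε =>
    ⟨∅, isCompact_empty, fun x hx => absurd hx (by simpa using hε)⟩⟩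
  add_mem' := by
    rintro f g ⟨hf, hf'⟩ ⟨hg, hg'⟩
    refine ⟨fun r x => by simp [hf r x, hg r x], fun ε hε => ?_⟩
    obtain ⟨C, hC, h⟩ := hf' (ε / 2) (by positivity)
    obtain ⟨C', hC', h'⟩ := hg' (ε / 2) (by positivity)
    refine ⟨C ∪ C', hC.union hC', fun x hx => ?_⟩
    by_cases hx1 : ε / 2 ≤ ‖f x‖
    · obtain ⟨r, hr, c, hc, e⟩ := h x hx1
      exact ⟨r, hr, c, Or.inl hc, e⟩
    · by_cases hx2 : ε / 2 ≤ ‖g x‖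
      · obtain ⟨r, hr, c, hc, e⟩ := h' x hx2
        exact ⟨r, hr, c, Or.inr hc, e⟩
      · have := norm_add_le (f x) (g x)
        rw [BoundedContinuousFunction.add_apply] at hx
        linarith
  mul_mem' := by
    rintro f g ⟨hf, hf'⟩ ⟨hg, -⟩
    refine ⟨fun r x => by simp [hf r x, hg r x], fun ε hε => ?_⟩
    obtain ⟨C, hC, h⟩ := hf' (ε / (‖g‖ + 1)) (by positivity)
    refine ⟨C, hC, fun x hx => h x ?_⟩
    rw [div_le_iff₀ (by positivity)]
    refine hx.trans ((norm_mul_le _ _).trans ?_)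
    gcongr
    exact (g.norm_coe_le_norm x).trans (by linarith)
  smul_mem' := by
    rintro c f ⟨hf, hf'⟩
    refine ⟨fun r x => by simp [hf r x], fun ε hε => ?_⟩
    obtain ⟨C, hC, h⟩ := hf' (ε / (‖c‖ + 1)) (by positivity)
    refine ⟨C, hC, fun x hx => h x ?_⟩
    rw [div_le_iff₀ (by positivity)]
    refine hx.trans ?_
    rw [BoundedContinuousFunction.smul_apply, norm_smul, mul_comm]
    gcongr
    linarith
  star_mem' := by
    rintro f ⟨hf, hf'⟩
    refine ⟨fun r x => by simp [hf r x, map_star], fun ε hε => ?_⟩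
    obtain ⟨C, hC, h⟩ := hf' ε hε
    exact ⟨C, hC, fun x hx => h x (by simpa using hx)⟩

theorem mem_induced {D : TwistedSystem φ N A} {f : G →ᵇ A} : f ∈ induced D ↔
    (∀ (r : N) (x : G), f (r * x) = ad (D.u r x)⁻¹ (D.α r (f x))) ∧ VanishesModulo N id f :=
  Iff.rfl

instance isClosed_induced (D : TwistedSystem φ N A) : IsClosed (induced D : Set (G →ᵇ A)) := by
  have h1 : IsClosed {f : G →ᵇ A | ∀ (r : N) (x : G),
      f (r * x) = ad (D.u r x)⁻¹ (D.α r (f x))} := by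
    simp only [Set.ofPred_forall]
    refine isClosed_iInter fun r => isClosed_iInter fun x => isClosed_eq ?_ ?_
    · exact continuous_eval_const _
    · exact (StarAlgEquiv.isometry _).continuous.comp
        ((StarAlgEquiv.isometry _).continuous.comp (continuous_eval_const _))
  have h2 : IsClosed {f : G →ᵇ A | VanishesModulo N id f} := by
    refine isClosed_of_closure_subset fun f hf ε hε => ?_
    obtain ⟨g, hg, hfg⟩ := Metric.mem_closure_iff.1 hf (ε / 2) (by positivity)
    obtain ⟨C, hC, h⟩ := hg (ε / 2) (by positivity)
    refine ⟨C, hC, fun x hx => h x ?_⟩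
    have h3 := (BoundedContinuousFunction.dist_coe_le_dist x).trans_lt hfg
    rw [dist_eq_norm] at h3
    have := norm_sub_norm_le (f x) (g x)
    linarith
  exact h1.inter h2

/-- `u-ind_N^G(A)` is a C⋆-algebra. -/
instance (D : TwistedSystem φ N A) : NonUnitalCStarAlgebra (induced D) :=
  NonUnitalStarSubalgebra.nonUnitalCStarAlgebra _


theorem coe_scal_mul (c : Circle) (w : unitary 𝓜(ℂ, A)) :
    (scal c * w : unitary 𝓜(ℂ, A)).1 = (c : ℂ) • w.1 := by
  rw [Submonoid.coe_mul, Algebra.smul_def]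
  rfl

theorem coe_scal (c : Circle) : (scal c : unitary 𝓜(ℂ, A)).1 = (c : ℂ) • 1 :=
  Algebra.algebraMap_eq_smul_one _

theorem scal_inv (c : Circle) : (scal c : unitary 𝓜(ℂ, A))⁻¹ = scal c⁻¹ := by
  rw [inv_eq_iff_mul_eq_one, ← scal_mul, mul_inv_cancel, scal_one]

theorem scal_mul_inv (c : Circle) (w : unitary 𝓜(ℂ, A)) :
    (scal c * w)⁻¹ = scal c⁻¹ * w⁻¹ := by
  rw [mul_inv_rev, scal_inv]
  exact Subtype.ext (by rw [Submonoid.coe_mul, Submonoid.coe_mul, scal_comm])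

theorem ad_scal_mul (c : Circle) (w : unitary 𝓜(ℂ, A)) (a : A) : ad (scal c * w) a = ad w a :=
  emb_injective (by
    rw [emb_ad, emb_ad, scal_mul_inv, coe_scal_mul, coe_scal_mul, mul_smul_comm, smul_mul_assoc,
      mul_smul_comm, smul_smul, Circle.coe_inv, mul_inv_cancel₀ (Circle.coe_ne_zero c), one_smul])

theorem extendU_mul (α : A ≃⋆ₐ[ℂ] A) (w w' : unitary 𝓜(ℂ, A)) :
    extendU α (w * w') = extendU α w * extendU α w' :=
  Subtype.ext (map_mul (extend α) _ _)

theorem extendU_inv (α : A ≃⋆ₐ[ℂ] A) (w : unitary 𝓜(ℂ, A)) :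
    extendU α w⁻¹ = (extendU α w)⁻¹ :=
  Subtype.ext (map_star (extend α) _)

theorem extendU_scal (α : A ≃⋆ₐ[ℂ] A) (c : Circle) : extendU α (scal c) = scal c :=
  Subtype.ext (extend_scal α c)

theorem TwistedSystem.cocycleU (D : TwistedSystem φ N A) (r : N) (x y : G) :
    extendU (D.α r) (D.u x y) = scal (φ r x y) * (D.u r x * (D.u (r * x) y * (D.u r (x * y))⁻¹)) := by
  rw [← mul_assoc, ← mul_assoc, eq_mul_inv_iff_mul_eq]
  refine Subtype.ext ?_
  have h := D.cocycle r x y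
  change extend (D.α r) (D.u x y) * (D.u r (x * y) : 𝓜(ℂ, A)) = _
  rw [h, Algebra.smul_def, ← mul_assoc]
  rfl

theorem norm_ad (w : unitary 𝓜(ℂ, A)) (a : A) : ‖ad w a‖ = ‖a‖ := StarAlgEquiv.norm_map _ _

theorem StrictlyContinuous.comp {X Y : Type*} [TopologicalSpace X] [TopologicalSpace Y]
    {m : X → 𝓜(ℂ, A)} (h : StrictlyContinuous m) {f : Y → X} (hf : Continuous f) :
    StrictlyContinuous fun y => m (f y) :=
  fun a => ⟨(h a).1.comp hf, (h a).2.comp hf⟩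

theorem beta_aux (D : TwistedSystem φ N A) (r : N) (x y : G) (a : A) :
    ad (D.u (r * x) y) (ad (D.u r (x * y))⁻¹ a) =
      ad (D.u r x)⁻¹ (ad (extendU (D.α r) (D.u x y)) a) := by
  rw [D.cocycleU, ad_scal_mul, ← ad_mul, ← ad_mul]
  simp

/-- The function `v(y,z) : x ↦ φ(x,y,z) u(x,y) u(xy,z) u(x,yz)⁻¹`. -/
def vFun (D : TwistedSystem φ N A) (y z x : G) : unitary 𝓜(ℂ, A) :=
  scal (φ x y z) * (D.u x y * D.u (x * y) z * (D.u x (y * z))⁻¹)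

theorem vFun_mul (D : TwistedSystem φ N A) (r : N) (y z x : G) :
    vFun D y z (r * x) = (D.u r x)⁻¹ * extendU (D.α r) (vFun D y z x) * D.u r x := by
  have hs : φ (r * x) y z = φ x y z * (φ r x y * (φ r (x * y) z * (φ r x (y * z))⁻¹)) := by
    rw [φ.mul_left, φ.mul_mid, φ.mul_right, mul_inv]
    calc _ = φ x y z * φ r y z * (φ r x y * (φ r x y)⁻¹) * (φ r x z * (φ r x z)⁻¹) := by
          simp [mul_comm]
      _ = _ := by ac_rfl
  refine Subtype.ext ?_
  unfold vFun
  rw [hs]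
  simp only [extendU_mul, extendU_inv, extendU_scal, D.cocycleU, scal_inv, mul_inv_rev,
    inv_inv, mul_assoc, Submonoid.coe_mul, coe_scal, scal_mul, mul_smul_comm, smul_mul_assoc,
    one_mul, inv_mul_cancel_coe, inv_mul_coe, mul_one, smul_smul]

variable [IsTopologicalGroup G]

/-- The function `x ↦ ad(w(x)) [f(xy)]`, as an element of `u-ind_N^G(A)`. -/
def translate (D : TwistedSystem φ N A) (y : G) (w : G → unitary 𝓜(ℂ, A))
    (hw : StrictlyContinuous fun x => (w x : 𝓜(ℂ, A)))
    (hwD : ∀ (r : N) (x : G) (a : A), ad (w (r * x)) (ad (D.u r (x * y))⁻¹ a) =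
      ad (D.u r x)⁻¹ (ad (extendU (D.α r) (w x)) a))
    (f : induced D) : induced D :=
  ⟨BoundedContinuousFunction.ofNormedAddCommGroup (fun x => ad (w x) (f.1 (x * y)))
      (hw.ad (f.1.continuous.comp (continuous_mul_const y))) ‖f.1‖
      (fun x => by rw [norm_ad]; exact f.1.norm_coe_le_norm _),
    ⟨fun r x => by
      change ad (w (r * x)) (f.1 (r * x * y)) = ad (D.u r x)⁻¹ (D.α r (ad (w x) (f.1 (x * y))))
      rw [ad_aut, ← hwD, mul_assoc, f.2.1],
    fun ε hε => by
      obtain ⟨C, hC, h⟩ := f.2.2 ε hε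
      refine ⟨(fun c => c * y⁻¹) '' C, hC.image (continuous_mul_const _), fun x hx => ?_⟩
      have hx' : ε ≤ ‖ad (w x) (f.1 (x * y))‖ := hx
      rw [norm_ad] at hx'
      obtain ⟨r, hr, c, hc, e⟩ := h _ hx'
      refine ⟨r, hr, _, ⟨c, hc, rfl⟩, ?_⟩
      have e' : x * y = r * c := e
      rw [id, ← mul_assoc, ← e', mul_inv_cancel_right]⟩⟩

theorem translate_apply (D : TwistedSystem φ N A) (y : G) (w : G → unitary 𝓜(ℂ, A)) (hw) (hwD)
    (f : induced D) (x : G) : (translate D y w hw hwD f).1 x = ad (w x) (f.1 (x * y)) := rfl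

/-- The automorphisms `β_y[f](x) = ad(u(x,y))[f(xy)]` of `u-ind_N^G(A)`. -/
def beta (D : TwistedSystem φ N A) (y : G) : induced D ≃⋆ₐ[ℂ] induced D where
  toFun := translate D y (fun x => D.u x y)
    (D.u_continuous.comp (f := fun x => (x, y)) (by fun_prop)) (fun r x a => beta_aux D r x y a)
  invFun := translate D y⁻¹ (fun x => (D.u (x * y⁻¹) y)⁻¹)
    (StrictlyContinuous.inv (w := fun x => D.u (x * y⁻¹) y)
      (D.u_continuous.comp (f := fun x => (x * y⁻¹, y)) (by fun_prop)))
    (fun r x a => by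
      have h := beta_aux D r (x * y⁻¹) y
      rw [extendU_inv]
      have h2 : ∀ b, ad (D.u r x)⁻¹ b = ad (D.u (r * (x * y⁻¹)) y)⁻¹
          (ad (D.u r (x * y⁻¹))⁻¹ (ad (extendU (D.α r) (D.u (x * y⁻¹) y)) b)) := fun b => by
        rw [← h, inv_mul_cancel_right, ← ad_mul, inv_mul_cancel, ad_one]
      rw [h2, ← ad_mul (extendU _ _), mul_inv_cancel, ad_one, mul_assoc])
  left_inv f := Subtype.ext (BoundedContinuousFunction.ext fun x => by
    simp only [translate_apply, inv_mul_cancel_right]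
    rw [← ad_mul, inv_mul_cancel, ad_one])
  right_inv f := Subtype.ext (BoundedContinuousFunction.ext fun x => by
    simp only [translate_apply, mul_inv_cancel_right]
    rw [← ad_mul, mul_inv_cancel, ad_one])
  map_mul' f g := Subtype.ext (BoundedContinuousFunction.ext fun x =>
    map_mul (ad (D.u x y)) (f.1 (x * y)) (g.1 (x * y)))
  map_add' f g := Subtype.ext (BoundedContinuousFunction.ext fun x =>
    map_add (ad (D.u x y)) (f.1 (x * y)) (g.1 (x * y)))
  map_smul' c f := Subtype.ext (BoundedContinuousFunction.ext fun x =>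
    map_smul (ad (D.u x y)) c (f.1 (x * y)))
  map_star' f := Subtype.ext (BoundedContinuousFunction.ext fun x =>
    map_star (ad (D.u x y)) (f.1 (x * y)))

theorem beta_apply (D : TwistedSystem φ N A) (y : G) (f : induced D) (x : G) :
    (beta D y f).1 x = ad (D.u x y) (f.1 (x * y)) := rfl

/-- Pointwise multiplication from the left by an equivariant family of unitaries. -/
def mulFst (D : TwistedSystem φ N A) (w : G → unitary 𝓜(ℂ, A))
    (hw : StrictlyContinuous fun x => (w x : 𝓜(ℂ, A)))
    (hwD : ∀ (r : N) (x : G), w (r * x) = (D.u r x)⁻¹ * extendU (D.α r) (w x) * D.u r x)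
    (f : induced D) : induced D :=
  ⟨BoundedContinuousFunction.ofNormedAddCommGroup (fun x => (w x : 𝓜(ℂ, A)) ▷ f.1 x)
      (hw.lmul f.1.continuous) ‖f.1‖
      (fun x => by rw [norm_unitary_lmul]; exact f.1.norm_coe_le_norm _),
    ⟨fun r x => by
      change (w (r * x) : 𝓜(ℂ, A)) ▷ f.1 (r * x) =
        ad (D.u r x)⁻¹ (D.α r ((w x : 𝓜(ℂ, A)) ▷ f.1 x))
      refine emb_injective ?_
      rw [f.2.1, hwD, lmul_extend, emb_lmul, emb_ad, emb_ad, emb_lmul]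
      simp only [Submonoid.coe_mul, mul_assoc, mul_inv_cancel_coe]
      rfl,
    fun ε hε => by
      obtain ⟨C, hC, h⟩ := f.2.2 ε hε
      refine ⟨C, hC, fun x hx => h x ?_⟩
      have hx' : ε ≤ ‖(w x : 𝓜(ℂ, A)) ▷ f.1 x‖ := hx
      rwa [norm_unitary_lmul] at hx'⟩⟩

/-- Pointwise multiplication from the right by an equivariant family of unitaries. -/
def mulSnd (D : TwistedSystem φ N A) (w : G → unitary 𝓜(ℂ, A))
    (hw : StrictlyContinuous fun x => (w x : 𝓜(ℂ, A)))
    (hwD : ∀ (r : N) (x : G), w (r * x) = (D.u r x)⁻¹ * extendU (D.α r) (w x) * D.u r x)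
    (f : induced D) : induced D :=
  ⟨BoundedContinuousFunction.ofNormedAddCommGroup (fun x => f.1 x ◁ (w x : 𝓜(ℂ, A)))
      (hw.rmul f.1.continuous) ‖f.1‖
      (fun x => by rw [norm_unitary_rmul]; exact f.1.norm_coe_le_norm _),
    ⟨fun r x => by
      change f.1 (r * x) ◁ (w (r * x) : 𝓜(ℂ, A)) =
        ad (D.u r x)⁻¹ (D.α r (f.1 x ◁ (w x : 𝓜(ℂ, A))))
      refine emb_injective ?_
      rw [f.2.1, hwD, rmul_extend, emb_rmul, emb_ad, emb_ad, emb_rmul]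
      simp only [Submonoid.coe_mul, mul_assoc, inv_inv, mul_inv_cancel_coe]
      rfl,
    fun ε hε => by
      obtain ⟨C, hC, h⟩ := f.2.2 ε hε
      refine ⟨C, hC, fun x hx => h x ?_⟩
      have hx' : ε ≤ ‖f.1 x ◁ (w x : 𝓜(ℂ, A))‖ := hx
      rwa [norm_unitary_rmul] at hx'⟩⟩

/-- An equivariant family of unitaries as a multiplier of `u-ind_N^G(A)`, acting pointwise. -/
def inducedMultiplier (D : TwistedSystem φ N A) (w : G → unitary 𝓜(ℂ, A))
    (hw : StrictlyContinuous fun x => (w x : 𝓜(ℂ, A)))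
    (hwD : ∀ (r : N) (x : G), w (r * x) = (D.u r x)⁻¹ * extendU (D.α r) (w x) * D.u r x) :
    𝓜(ℂ, induced D) where
  fst := LinearMap.mkContinuous
    { toFun := mulFst D w hw hwD
      map_add' := fun f g => Subtype.ext (BoundedContinuousFunction.ext fun x =>
        map_add (w x : 𝓜(ℂ, A)).fst (f.1 x) (g.1 x))
      map_smul' := fun c f => Subtype.ext (BoundedContinuousFunction.ext fun x =>
        map_smul (w x : 𝓜(ℂ, A)).fst c (f.1 x)) } 1
    (fun f => by
      rw [one_mul]
      refine (BoundedContinuousFunction.norm_le (norm_nonneg _)).2 fun x => ?_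
      exact (norm_unitary_lmul (w x) (f.1 x)).trans_le (f.1.norm_coe_le_norm x))
  snd := LinearMap.mkContinuous
    { toFun := mulSnd D w hw hwD
      map_add' := fun f g => Subtype.ext (BoundedContinuousFunction.ext fun x =>
        map_add (w x : 𝓜(ℂ, A)).snd (f.1 x) (g.1 x))
      map_smul' := fun c f => Subtype.ext (BoundedContinuousFunction.ext fun x =>
        map_smul (w x : 𝓜(ℂ, A)).snd c (f.1 x)) } 1
    (fun f => by
      rw [one_mul]
      refine (BoundedContinuousFunction.norm_le (norm_nonneg _)).2 fun x => ?_
      exact (norm_unitary_rmul (w x) (f.1 x)).trans_le (f.1.norm_coe_le_norm x))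
  central f g := Subtype.ext (BoundedContinuousFunction.ext fun x =>
    rmul_mul (f.1 x) (w x) (g.1 x))

theorem vFun_continuous (D : TwistedSystem φ N A) (y z : G) :
    StrictlyContinuous fun x => (vFun D y z x : 𝓜(ℂ, A)) := by
  have h1 : StrictlyContinuous fun x => (D.u x y : 𝓜(ℂ, A)) :=
    D.u_continuous.comp (f := fun x => (x, y)) (by fun_prop)
  have h2 : StrictlyContinuous fun x => (D.u (x * y) z : 𝓜(ℂ, A)) :=
    D.u_continuous.comp (f := fun x => (x * y, z)) (by fun_prop)
  have h3 : StrictlyContinuous fun x => (D.u x (y * z) : 𝓜(ℂ, A)) :=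
    D.u_continuous.comp (f := fun x => (x, y * z)) (by fun_prop)
  have h4 : Continuous fun x => (φ x y z : ℂ) := continuous_subtype_val.comp
    (φ.continuous'.comp (f := fun x => (x, y, z)) (by fun_prop))
  refine fun a => ⟨(h4.smul (h1.lmul (h2.lmul (h3.inv.lmul (continuous_const (y := a)))))).congr
      fun x => emb_injective ?_,
    (h4.smul (h3.inv.rmul (h2.rmul (h1.rmul (continuous_const (y := a)))))).congr
      fun x => emb_injective ?_⟩
  · have e : ∀ (c : ℂ) (b : A), emb (c • b) = c • emb b := fun c b => map_smul _ c b
    simp only [e, emb_lmul, vFun, Pi.smul_apply', coe_scal, Submonoid.coe_mul, smul_mul_assoc, one_mul,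
      mul_assoc]
  · have e : ∀ (c : ℂ) (b : A), emb (c • b) = c • emb b := fun c b => map_smul _ c b
    simp only [e, emb_rmul, vFun, Pi.smul_apply', coe_scal, Submonoid.coe_mul, mul_smul_comm, smul_mul_assoc,
      one_mul,
      mul_assoc]

/-- The unitary multipliers `v(y,z) : x ↦ φ(x,y,z) u(x,y) u(xy,z) u(x,yz)⁻¹` of `u-ind_N^G(A)`,
acting by pointwise multiplication. -/
def v (D : TwistedSystem φ N A) (y z : G) : unitary 𝓜(ℂ, induced D) :=
  ⟨inducedMultiplier D (vFun D y z) (vFun_continuous D y z) (fun r x => vFun_mul D r y z x), by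
    rw [Unitary.mem_iff]
    constructor
    · refine mult_ext (fun f => Subtype.ext (BoundedContinuousFunction.ext fun x => ?_))
        (fun f => Subtype.ext (BoundedContinuousFunction.ext fun x => ?_))
      · change star (star ((vFun D y z x : 𝓜(ℂ, A)) ▷ f.1 x) ◁ (vFun D y z x : 𝓜(ℂ, A))) = f.1 x
        refine emb_injective ?_
        simp only [emb_star, emb_rmul, emb_lmul, star_mul, star_star, star_coe, inv_inv,
          inv_mul_cancel_coe]
      · change star ((vFun D y z x : 𝓜(ℂ, A)) ▷ star (f.1 x)) ◁ (vFun D y z x : 𝓜(ℂ, A)) = f.1 x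
        refine emb_injective ?_
        simp only [emb_star, emb_rmul, emb_lmul, star_mul, star_star, star_coe, mul_assoc,
          inv_mul_coe, mul_one]
    · refine mult_ext (fun f => Subtype.ext (BoundedContinuousFunction.ext fun x => ?_))
        (fun f => Subtype.ext (BoundedContinuousFunction.ext fun x => ?_))
      · change (vFun D y z x : 𝓜(ℂ, A)) ▷ star (star (f.1 x) ◁ (vFun D y z x : 𝓜(ℂ, A))) = f.1 x
        refine emb_injective ?_
        simp only [emb_star, emb_rmul, emb_lmul, star_mul, star_star, star_coe, mul_inv_cancel_coe]
      · change star ((vFun D y z x : 𝓜(ℂ, A)) ▷ star (f.1 x ◁ (vFun D y z x : 𝓜(ℂ, A)))) = f.1 x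
        refine emb_injective ?_
        simp only [emb_star, emb_rmul, emb_lmul, star_mul, star_star, star_coe, mul_assoc,
          inv_inv, coe_mul_inv, mul_one]⟩

theorem v_lmul (D : TwistedSystem φ N A) (y z : G) (f : induced D) (x : G) :
    ((v D y z : 𝓜(ℂ, induced D)) ▷ f).1 x = (vFun D y z x : 𝓜(ℂ, A)) ▷ f.1 x := rfl

theorem v_rmul (D : TwistedSystem φ N A) (y z : G) (f : induced D) (x : G) :
    (f ◁ (v D y z : 𝓜(ℂ, induced D))).1 x = f.1 x ◁ (vFun D y z x : 𝓜(ℂ, A)) := rfl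

end Systems

section CrossedProduct

variable {G : Type*} [Group G] [TopologicalSpace G] [MeasurableSpace G]
  {B : Type*} [NonUnitalCStarAlgebra B]

/-- The twisted convolution product `(F₁ * F₂)(x) = ∫ F₁(y) β_y[F₂(y⁻¹x)] v(y, y⁻¹x) dy`. -/
def conv (μ : Measure G) (β : G → B ≃⋆ₐ[ℂ] B) (v : G → G → unitary 𝓜(ℂ, B))
    (F₁ F₂ : G → B) : G → B :=
  fun x => ∫ y, (F₁ y * β y (F₂ (y⁻¹ * x))) ◁ (v y (y⁻¹ * x) : 𝓜(ℂ, B)) ∂μ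

/-- The twisted involution `F*(x) = v(x, x⁻¹)⁻¹ β_x[F(x⁻¹)]*`. -/
def convStar (β : G → B ≃⋆ₐ[ℂ] B) (v : G → G → unitary 𝓜(ℂ, B)) (F : G → B) : G → B :=
  fun x => (↑(v x x⁻¹)⁻¹ : 𝓜(ℂ, B)) ▷ star (β x (F x⁻¹))

/-- The space of continuous compactly supported functions `G → B`. -/
def CompactlySupported (G B : Type*) [TopologicalSpace G] [NonUnitalCStarAlgebra B] :
    Submodule ℂ (G → B) where
  carrier := {F | Continuous F ∧ HasCompactSupport F}
  zero_mem' := ⟨continuous_zero, HasCompactSupport.zero⟩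
  add_mem' hf hg := ⟨hf.1.add hg.1, hf.2.add hg.2⟩
  smul_mem' c _ hf := ⟨hf.1.const_smul c, hf.2.smul_left (f := fun _ => c)⟩

/-- The norm `‖F‖₂ = ‖(F* * F)(1)‖^{1/2}` of the Hilbert `B`-module `L²(G, B)`, on which the left
regular representation acts. -/
def convL2 (μ : Measure G) (β : G → B ≃⋆ₐ[ℂ] B) (v : G → G → unitary 𝓜(ℂ, B))
    (F : G → B) : ℝ≥0∞ :=
  ‖conv μ β v (convStar β v F) F 1‖ₑ ^ (1 / 2 : ℝ)

/-- The norm of the left regular representation: the norm of the operator `F' ↦ F * F'` with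
respect to `‖·‖₂`. -/
def convNorm (μ : Measure G) (β : G → B ≃⋆ₐ[ℂ] B) (v : G → G → unitary 𝓜(ℂ, B))
    (F : G → B) : ℝ≥0∞ :=
  ⨆ F' ∈ {F' ∈ CompactlySupported G B | convL2 μ β v F' ≤ 1}, convL2 μ β v (conv μ β v F F')

end CrossedProduct

section Kernels

variable {G : Type*} [Group G] [TopologicalSpace G] {A : Type*} [NonUnitalCStarAlgebra A]
  {φ : Tricharacter G} {N : Subgroup G}

/-- The space of `A`-valued kernels: continuous functions `K` on `G × G` with
`K(rz, rw) = φ(r,z,w)⁻¹ u(r,z)⁻¹ α_r[K(z,w)] u(r,w)` for `r ∈ N`, such that `K(z,w) = 0` unless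
`z⁻¹w` lies in some compact set, and such that `‖K(z,w)‖` (which is invariant under `N`) tends to
zero when `z` tends to infinity in `N\G`. -/
def Kernels (D : TwistedSystem φ N A) : Submodule ℂ (G → G → A) where
  carrier := {K | Continuous (fun p : G × G => K p.1 p.2) ∧
    (∀ (r : N) (z w : G), K (r * z) (r * w) =
      ((φ r z w)⁻¹ : ℂ) •
        (((↑(D.u r z)⁻¹ : 𝓜(ℂ, A)) ▷ D.α r (K z w)) ◁ (D.u r w : 𝓜(ℂ, A)))) ∧
    (∃ C : Set G, IsCompact C ∧ ∀ z w, K z w ≠ 0 → z⁻¹ * w ∈ C) ∧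
    VanishesModulo N Prod.fst (fun p : G × G => K p.1 p.2)}
  zero_mem' := ⟨continuous_const, fun r z w => by simp [lmul, rmul],
    ⟨∅, isCompact_empty, fun z w h => absurd rfl h⟩, fun ε hε =>
    ⟨∅, isCompact_empty, fun x hx => absurd hx (by simpa using hε)⟩⟩
  add_mem' := by
    rintro f g ⟨hf, hf1, ⟨C1, hC1, hf2⟩, hf'⟩ ⟨hg, hg1, ⟨C2, hC2, hg2⟩, hg'⟩
    refine ⟨hf.add hg, fun r z w => by simp [hf1 r z w, hg1 r z w, lmul, rmul],
      ⟨C1 ∪ C2, hC1.union hC2, fun z w h => ?_⟩, fun ε hε => ?_⟩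
    · by_contra hc
      rw [Set.mem_union, not_or] at hc
      refine h ?_
      rw [Pi.add_apply, Pi.add_apply, not_not.1 (mt (hf2 z w) hc.1), not_not.1 (mt (hg2 z w) hc.2),
        add_zero]
    obtain ⟨C, hC, h⟩ := hf' (ε / 2) (by positivity)
    obtain ⟨C', hC', h'⟩ := hg' (ε / 2) (by positivity)
    refine ⟨C ∪ C', hC.union hC', fun x hx => ?_⟩
    by_cases hx1 : ε / 2 ≤ ‖f x.1 x.2‖
    · obtain ⟨r, hr, c, hc, e⟩ := h x hx1
      exact ⟨r, hr, c, Or.inl hc, e⟩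
    · by_cases hx2 : ε / 2 ≤ ‖g x.1 x.2‖
      · obtain ⟨r, hr, c, hc, e⟩ := h' x hx2
        exact ⟨r, hr, c, Or.inr hc, e⟩
      · have := norm_add_le (f x.1 x.2) (g x.1 x.2)
        have hx' : ε ≤ ‖f x.1 x.2 + g x.1 x.2‖ := hx
        linarith
  smul_mem' := by
    rintro c f ⟨hf, hf1, ⟨C1, hC1, hf2⟩, hf'⟩
    refine ⟨hf.const_smul c, fun r z w => ?_, ⟨C1, hC1, fun z w h => hf2 z w fun h0 => h ?_⟩,
      fun ε hε => ?_⟩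
    · simp only [Pi.smul_apply, hf1 r z w, map_smul, lmul, rmul]
      rw [smul_comm]
    · rw [Pi.smul_apply, Pi.smul_apply, h0, smul_zero]
    obtain ⟨C, hC, h⟩ := hf' (ε / (‖c‖ + 1)) (by positivity)
    refine ⟨C, hC, fun x hx => h x ?_⟩
    rw [div_le_iff₀ (by positivity)]
    refine hx.trans ?_
    change ‖c • f x.1 x.2‖ ≤ ‖f x.1 x.2‖ * (‖c‖ + 1)
    rw [norm_smul, mul_comm]
    gcongr
    linarith

/-- The involution `K*(z,w) = K(w,z)*` of kernels. -/
def kerStar (K : G → G → A) : G → G → A := fun z w => star (K w z)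

/-- The twisted product `(K₁ ⋆ K₂)(z,w) = ∫ K₁(z,v) K₂(v,w) φ(z,v,w) dv` of kernels. -/
def kerMul [MeasurableSpace G] (μ : Measure G) (φ : Tricharacter G) (K₁ K₂ : G → G → A) :
    G → G → A :=
  fun z w => ∫ v, (φ z v w : ℂ) • (K₁ z v * K₂ v w) ∂μ

/-- The norm `‖K‖₂ = sup_z ‖(K* ⋆ K)(z,z)‖^{1/2}` of kernels. -/
def kerL2 [MeasurableSpace G] (μ : Measure G) (φ : Tricharacter G) (K : G → G → A) : ℝ≥0∞ :=
  ⨆ z, ‖kerMul μ φ (kerStar K) K z z‖ₑ ^ (1 / 2 : ℝ)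

/-- The norm of the left regular representation of the kernels: the norm of the operator
`K' ↦ K ⋆ K'` with respect to `‖·‖₂`. -/
def kerNorm [MeasurableSpace G] (μ : Measure G) (D : TwistedSystem φ N A) (K : G → G → A) :
    ℝ≥0∞ :=
  ⨆ K' ∈ {K' ∈ Kernels D | kerL2 μ φ K' ≤ 1}, kerL2 μ φ (kerMul μ φ K K')

end Kernels

section StarAlgebras

/-- `V` is a (not necessarily associative) complex ⋆-algebra with the product `mul` and the
involution `inv`. -/
structure IsStarAlgebra {W : Type*} [AddCommGroup W] [Module ℂ W] (V : Submodule ℂ W)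
    (mul : W → W → W) (inv : W → W) : Prop where
  mul_mem : ∀ a ∈ V, ∀ b ∈ V, mul a b ∈ V
  add_mul : ∀ a ∈ V, ∀ b ∈ V, ∀ c ∈ V, mul (a + b) c = mul a c + mul b c
  mul_add : ∀ a ∈ V, ∀ b ∈ V, ∀ c ∈ V, mul a (b + c) = mul a b + mul a c
  smul_mul : ∀ (t : ℂ), ∀ a ∈ V, ∀ b ∈ V, mul (t • a) b = t • mul a b
  mul_smul : ∀ (t : ℂ), ∀ a ∈ V, ∀ b ∈ V, mul a (t • b) = t • mul a b
  inv_mem : ∀ a ∈ V, inv a ∈ V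
  inv_inv : ∀ a ∈ V, inv (inv a) = a
  inv_add : ∀ a ∈ V, ∀ b ∈ V, inv (a + b) = inv a + inv b
  inv_smul : ∀ (t : ℂ), ∀ a ∈ V, inv (t • a) = star t • inv a
  inv_mul : ∀ a ∈ V, ∀ b ∈ V, inv (mul a b) = mul (inv b) (inv a)

variable {W : Type*} [AddCommGroup W] [Module ℂ W] {V : Submodule ℂ W}
  {X : Type*} [NormedAddCommGroup X] [NormedSpace ℂ X]

/-- `X` with the map `i : V → X` is the completion of `V` in the norm `nrm`. -/
structure IsCompletion (nrm : W → ℝ≥0∞) (i : V →ₗ[ℂ] X) : Prop where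
  complete : CompleteSpace X
  enorm_eq : ∀ a : V, ‖i a‖ₑ = nrm a
  dense : DenseRange i

/-- `c` is a product of `a` and `b` in the completion `X` of `V`: it is a limit of products
`a_n b_n ∈ V` along a net with `a_n → a`, `b_n → b`. -/
def IsLimitProduct (mul : W → W → W) (i : V →ₗ[ℂ] X) (a b c : X) : Prop :=
  (a, b, c) ∈ closure {t : X × X × X | ∃ a' b' c' : V, (c' : W) = mul a' b' ∧ t = (i a', i b', i c')}

/-- `b` is the adjoint of `a` in the completion `X` of `V`: it is a limit of adjoints `a_n* ∈ V`
along a net with `a_n → a`. -/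
def IsLimitAdjoint (inv : W → W) (i : V →ₗ[ℂ] X) (a b : X) : Prop :=
  (a, b) ∈ closure {t : X × X | ∃ a' b' : V, (b' : W) = inv a' ∧ t = (i a', i b')}

end StarAlgebras

end TwistedInduction

end

/-!
The isomorphism `Φ` sends `F ∈ C_c(G, B)` to the kernel `(z, w) ↦ F(z⁻¹w)(z) u(z, z⁻¹w)` (`toKer`).
The cocycle identity for `u` turns the equivariance of the functions `F(x)` under `N` into that of
the kernel, and the substitution `v = zy` turns the twisted convolution into the product of kernels
(`toKer_conv`, `toKer_convStar`). A kernel `K` comes from `F(x)(z) = K(z, zx) u(z, x)⁻¹`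
(`exists_toKer_eq`); here the point is that `F` is continuous for the supremum norm, because up to
translation by `N` and up to small values everything happens on a compact set
(`continuous_of_vanishesModulo`). The same fact gives the existence of the convolution integrals in
`B`. Since `Φ` is injective and maps exactly `C_c(G, B)` onto the kernels, all assertions about
`C_c(G, B)` follow from those about kernels.

For kernels, `φ(z, v, z) = 1` gives `(K* ⋆ L)(w, w) = ∫ K(v, w)* L(v, w) dv`, so `‖K‖₂` is the
supremum over `w` of the norm of the column `K(·, w)` in the Hilbert `A`-module `L²(G, A)`, and left
multiplication by `K` acts on the columns with index `w` as the integral operator with kernel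
`φ(z, v, w) K(z, v)`. Although the product is not associative, these operators have the usual
properties for each fixed `w`:
* They are bounded (`exists_kerL2_mul_le`), being integrals over a compact set of translations
  composed with multiplications. Unimodularity enters here.
* The operators of `K*` and `K` are adjoint to each other (`integral_star_kerStar_mul`), since
  `φ(v, z, w)` is the conjugate of `φ(z, v, w)`. With the Cauchy–Schwarz inequality this shows that
  the involution is isometric (`kerNorm_star`).
* If left multiplication by `K` vanishes, then `(K ⋆ K*)(z, z) = ∫ K(z, v) K(z, v)* dv = 0`, and
  `K = 0` (`eq_zero_of_kerNorm_eq_zero`).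

The extension to the completions is the extension of a densely defined isometry, which maps the
closures defining products and adjoints onto each other (`exists_extension_of_isometric`).
-/

open scoped Pointwise

noncomputable section
namespace TwistedInduction

local infixr:72 " ▷ " => lmul
local infixl:72 " ◁ " => rmul

set_option linter.unusedSectionVars false

/-! ### The Hilbert module of square integrable functions -/

section HilbertModule

variable {X : Type*} [TopologicalSpace X] {A : Type*} [NonUnitalCStarAlgebra A]

theorem mul_mem_cc {f g : X → A} (hf : Continuous f)
    (hg : g ∈ CompactlySupported X A) : (fun x => f x * g x) ∈ CompactlySupported X A :=
  ⟨hf.mul hg.1, hg.2.mul_left⟩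

theorem star_mem_cc {f : X → A} (hf : f ∈ CompactlySupported X A) :
    (fun x => star (f x)) ∈ CompactlySupported X A :=
  ⟨hf.1.star, hf.2.comp_left (star_zero _)⟩

variable [MeasurableSpace X] [BorelSpace X]

/-- A continuous function with positive values in a C⋆-algebra and integral zero vanishes: on a
neighbourhood `U` of a point `x` where `f` is within `‖f x‖ / 2` of `f x`, positivity forces the
integral over `U` to be zero as well, whereas it is within `μ(U) ‖f x‖ / 2` of `μ(U) f x`. -/
theorem eq_zero_of_integral_eq_zero [PartialOrder A] [StarOrderedRing A] {μ : Measure X}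
    [μ.IsOpenPosMeasure] [IsLocallyFiniteMeasure μ] {f : X → A} (hf : Continuous f)
    (hfi : Integrable f μ) (hf0 : ∀ x, 0 ≤ f x) (h : ∫ x, f x ∂μ = 0) (x : X) : f x = 0 := by
  by_contra hx
  obtain ⟨V, hxV, hVo, hVlt⟩ := μ.exists_isOpen_measure_lt_top x
  have hε : 0 < ‖f x‖ / 2 := by positivity
  let U : Set X := V ∩ f ⁻¹' Metric.ball (f x) (‖f x‖ / 2)
  have hUo : IsOpen U := hVo.inter (Metric.isOpen_ball.preimage hf)
  have hxU : x ∈ U := ⟨hxV, by simpa using hε⟩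
  have hUlt : μ U < ⊤ := (measure_mono Set.inter_subset_left).trans_lt hVlt
  have hUpos : 0 < μ.real U :=
    ENNReal.toReal_pos (hUo.measure_pos μ ⟨x, hxU⟩).ne' hUlt.ne
  have h0 : ∫ y in U, f y ∂μ = 0 :=
    le_antisymm (h ▸ setIntegral_le_integral hfi (ae_of_all _ hf0)) (integral_nonneg hf0)
  have h1 : ‖∫ y in U, (f x - f y) ∂μ‖ ≤ ‖f x‖ / 2 * μ.real U := by
    refine norm_setIntegral_le_of_norm_le_const hUlt fun y hy => ?_
    have := hy.2
    rw [Set.mem_preimage, Metric.mem_ball', dist_eq_norm] at this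
    exact this.le
  have hc : Integrable (fun _ => f x) (μ.restrict U) := integrableOn_const hUlt.ne
  rw [integral_sub hc hfi.integrableOn, h0, sub_zero, setIntegral_const,
    norm_smul, Real.norm_of_nonneg hUpos.le] at h1
  nlinarith

theorem integrable_of_mem_cc {μ : Measure X} [IsFiniteMeasureOnCompacts μ] {f : X → A}
    (hf : f ∈ CompactlySupported X A) : Integrable f μ :=
  hf.1.integrable_of_hasCompactSupport hf.2

/-- The norm `‖∫ ξ* ξ‖^{1/2}` of the Hilbert `A`-module `L²(X, A)`. -/
def l2norm (μ : Measure X) (ξ : X → A) : ℝ := √‖∫ x, star (ξ x) * ξ x ∂μ‖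

theorem l2norm_nonneg (μ : Measure X) (ξ : X → A) : 0 ≤ l2norm μ ξ := Real.sqrt_nonneg _

theorem l2norm_sq (μ : Measure X) (ξ : X → A) :
    l2norm μ ξ ^ 2 = ‖∫ x, star (ξ x) * ξ x ∂μ‖ := Real.sq_sqrt (norm_nonneg _)

theorem l2norm_smul (μ : Measure X) (c : ℂ) (ξ : X → A) :
    l2norm μ (fun x => c • ξ x) = ‖c‖ * l2norm μ ξ := by
  have h : (∫ x, star (c • ξ x) * (c • ξ x) ∂μ) = (star c * c) • ∫ x, star (ξ x) * ξ x ∂μ := by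
    rw [← integral_smul]
    exact integral_congr_ae (ae_of_all _ fun x => by
      simp only [star_smul, smul_mul_smul_comm])
  rw [l2norm, h, norm_smul, Real.sqrt_mul (norm_nonneg _), norm_mul, norm_star,
    Real.sqrt_mul_self (norm_nonneg _), l2norm]

attribute [local instance] CStarAlgebra.spectralOrder CStarAlgebra.spectralOrderedRing

variable {μ : Measure X} [μ.IsOpenPosMeasure] [IsLocallyFiniteMeasure μ]

theorem l2norm_eq_zero {ξ : X → A} (hξ : ξ ∈ CompactlySupported X A) (h : l2norm μ ξ = 0)
    (x : X) : ξ x = 0 := by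
  rw [l2norm, Real.sqrt_eq_zero (norm_nonneg _), norm_eq_zero] at h
  have h2 := mul_mem_cc hξ.1.star hξ
  exact CStarRing.star_mul_self_eq_zero_iff _ |>.1 (eq_zero_of_integral_eq_zero h2.1
    (integrable_of_mem_cc h2) (fun x => star_mul_self_nonneg (ξ x)) h x)

variable (A μ) in
/-- The compactly supported functions `X → A` as a pre-Hilbert module with `⟪x, y⟫ = ∫ y x*`.
Mathlib's Hilbert modules are left modules, so that `x` corresponds to the element `x*` of the
right module `L²(X, A)`. -/
@[reducible] def cStarModule :
    letI : SMul A (CompactlySupported X A) :=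
      ⟨fun a f => ⟨fun x => a * f.1 x, mul_mem_cc continuous_const f.2⟩⟩
    letI : Norm (CompactlySupported X A) := ⟨fun f => √‖∫ x, f.1 x * star (f.1 x) ∂μ‖⟩
    CStarModule A (CompactlySupported X A) :=
  have hi (f g : CompactlySupported X A) : Integrable (fun x => f.1 x * star (g.1 x)) μ :=
    integrable_of_mem_cc (mul_mem_cc f.2.1 (star_mem_cc g.2))
  letI : SMul A (CompactlySupported X A) :=
      ⟨fun a f => ⟨fun x => a * f.1 x, mul_mem_cc continuous_const f.2⟩⟩
  letI : Norm (CompactlySupported X A) := ⟨fun f => √‖∫ x, f.1 x * star (f.1 x) ∂μ‖⟩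
  { inner := fun f g => ∫ x, g.1 x * star (f.1 x) ∂μ
    inner_add_right := fun {x y z} => by
      rw [← integral_add (hi y x) (hi z x)]
      exact integral_congr_ae (ae_of_all _ fun t => add_mul _ _ _)
    inner_self_nonneg := integral_nonneg fun x => mul_star_self_nonneg _
    inner_self := fun {f} => by
      refine ⟨fun h => Subtype.ext (funext fun x => ?_), fun h => by simp [h]⟩
      have h2 := mul_mem_cc f.2.1 (star_mem_cc f.2)
      exact CStarRing.mul_star_self_eq_zero_iff _ |>.1 (eq_zero_of_integral_eq_zero h2.1
        (integrable_of_mem_cc h2) (fun x => mul_star_self_nonneg (f.1 x)) h x)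
    inner_op_smul_right := fun {a x y} => by
      rw [← integral_const_mul_of_integrable (hi y x)]
      exact integral_congr_ae (ae_of_all _ fun t => mul_assoc _ _ _)
    inner_smul_right_complex := fun {z x y} => by
      rw [← integral_smul]
      exact integral_congr_ae (ae_of_all _ fun t => smul_mul_assoc _ _ _)
    star_inner := fun x y => by
      rw [← starL'_apply ℝ, ← ContinuousLinearEquiv.integral_comp_comm]
      exact integral_congr_ae (ae_of_all _ fun t => by simp)
    norm_eq_sqrt_norm_inner_self := fun x => rfl }

/-- The Cauchy–Schwarz inequality in the Hilbert `A`-module `L²(X, A)`. -/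
theorem norm_integral_star_mul_le {ξ η : X → A} (hξ : ξ ∈ CompactlySupported X A)
    (hη : η ∈ CompactlySupported X A) :
    ‖∫ x, star (ξ x) * η x ∂μ‖ ≤ l2norm μ ξ * l2norm μ η := by
  let : SMul A (CompactlySupported X A) :=
      ⟨fun a f => ⟨fun x => a * f.1 x, mul_mem_cc continuous_const f.2⟩⟩
  let : Norm (CompactlySupported X A) := ⟨fun f => √‖∫ x, f.1 x * star (f.1 x) ∂μ‖⟩
  let := cStarModule A μ
  have h := CStarModule.norm_inner_le (A := A) (CompactlySupported X A)
    (x := ⟨_, star_mem_cc hη⟩) (y := ⟨_, star_mem_cc hξ⟩)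
  change ‖∫ x, star (ξ x) * star (star (η x)) ∂μ‖ ≤ √‖∫ x, star (η x) * star (star (η x)) ∂μ‖ *
    √‖∫ x, star (ξ x) * star (star (ξ x)) ∂μ‖ at h
  simp only [star_star] at h
  rwa [mul_comm] at h

theorem l2norm_add_le {ξ η : X → A} (hξ : ξ ∈ CompactlySupported X A)
    (hη : η ∈ CompactlySupported X A) :
    l2norm μ (fun x => ξ x + η x) ≤ l2norm μ ξ + l2norm μ η := by
  let : SMul A (CompactlySupported X A) :=
      ⟨fun a f => ⟨fun x => a * f.1 x, mul_mem_cc continuous_const f.2⟩⟩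
  let : Norm (CompactlySupported X A) := ⟨fun f => √‖∫ x, f.1 x * star (f.1 x) ∂μ‖⟩
  let := cStarModule A μ
  have h := CStarModule.norm_triangle (E := CompactlySupported X A) A
    ⟨_, star_mem_cc hξ⟩ ⟨_, star_mem_cc hη⟩
  change √‖∫ x, (star (ξ x) + star (η x)) * star (star (ξ x) + star (η x)) ∂μ‖ ≤
    √‖∫ x, star (ξ x) * star (star (ξ x)) ∂μ‖ + √‖∫ x, star (η x) * star (star (η x)) ∂μ‖ at h
  simp only [star_star, star_add] at h
  simpa only [l2norm, star_add] using h

/-- Multiplication from the left by a function bounded by `M` has norm at most `M` on `L²(X, A)`. -/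
theorem l2norm_mul_le {M : ℝ} (hM : 0 ≤ M) {f ξ : X → A} (hf : Continuous f)
    (hfM : ∀ x, ‖f x‖ ≤ M)
    (hξ : ξ ∈ CompactlySupported X A) : l2norm μ (fun x => f x * ξ x) ≤ M * l2norm μ ξ := by
  have h1 := mul_mem_cc hf hξ
  have h2 := mul_mem_cc h1.1.star h1
  have h3 := mul_mem_cc hξ.1.star hξ
  have h : ‖∫ x, star (f x * ξ x) * (f x * ξ x) ∂μ‖ ≤ ‖(M * M) • ∫ x, star (ξ x) * ξ x ∂μ‖ := by
    refine CStarAlgebra.norm_le_norm_of_nonneg_of_le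
      (integral_nonneg fun x => star_mul_self_nonneg _) ?_
    rw [← integral_smul]
    refine integral_mono (integrable_of_mem_cc h2) ((integrable_of_mem_cc h3).smul _) fun x => ?_
    have e : star (f x * ξ x) * (f x * ξ x) = star (ξ x) * (star (f x) * f x) * ξ x := by
      simp only [star_mul, mul_assoc]
    change star (f x * ξ x) * (f x * ξ x) ≤ (M * M) • (star (ξ x) * ξ x)
    rw [e]
    refine (CStarAlgebra.star_left_conjugate_le_norm_smul (.star_mul_self _)).trans ?_
    refine smul_le_smul_of_nonneg_right ?_ (star_mul_self_nonneg _)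
    rw [CStarRing.norm_star_mul_self]
    exact mul_self_le_mul_self (norm_nonneg _) (hfM x)
  rw [norm_smul, Real.norm_of_nonneg (by positivity)] at h
  refine (Real.sqrt_le_sqrt h).trans_eq ?_
  rw [Real.sqrt_mul (by positivity), Real.sqrt_mul_self hM, l2norm]

end HilbertModule

/-! ### The ⋆-algebra of kernels -/

section KernelAlgebra

variable {G : Type*} [Group G] [TopologicalSpace G]

theorem Tricharacter.apply_outer (φ : Tricharacter G) (x y : G) : φ x y x = 1 := by
  rw [φ.swap_right, φ.diag, inv_one]

/-- The factors by which `φ` changes when all variables are translated by `r`: exactly what makes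
the product of two kernels equivariant again. -/
theorem Tricharacter.translate_all (φ : Tricharacter G) (r z y w : G) :
    φ (r * z) (r * y) (r * w) = φ z y w * (φ r z y * φ r y w * (φ r z w)⁻¹) := by
  have h1 : φ r (r * y) (r * w) = φ r y w := by
    rw [φ.mul_mid, φ.diag, one_mul, φ.mul_right, φ.apply_outer, one_mul]
  have h2 : φ z (r * y) (r * w) = (φ r z w)⁻¹ * (φ r z y * φ z y w) := by
    have h3 : φ z r r = 1 := by rw [φ.swap_left, φ.apply_outer, inv_one]
    have h4 : φ z y r = φ r z y := by rw [φ.swap_right, φ.swap_left, inv_inv]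
    rw [φ.mul_mid, φ.mul_right z r, h3, one_mul, φ.swap_left, φ.mul_right z y, h4]
  rw [φ.mul_left, h1, h2]
  calc _ = φ r y w * ((φ r z w)⁻¹ * (φ r z y * φ z y w)) := rfl
    _ = _ := by ac_rfl

theorem Tricharacter.continuous_comp (φ : Tricharacter G) {Y : Type*} [TopologicalSpace Y]
    {f g h : Y → G} (hf : Continuous f) (hg : Continuous g) (hh : Continuous h) :
    Continuous fun y => (φ (f y) (g y) (h y) : ℂ) :=
  continuous_subtype_val.comp (φ.continuous'.comp (hf.prodMk (hg.prodMk hh)))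

variable [IsTopologicalGroup G] [T2Space G] {φ : Tricharacter G} {N : Subgroup G}
  {A : Type*} [NonUnitalCStarAlgebra A] {D : TwistedSystem φ N A}

theorem norm_circle_smul (c : Circle) (a : A) : ‖(c : ℂ) • a‖ = ‖a‖ := by
  rw [norm_smul, Circle.norm_coe, one_mul]

theorem Kernels.norm_translate {K : G → G → A} (hK : K ∈ Kernels D) {r : G} (hr : r ∈ N)
    (z w : G) : ‖K (r * z) (r * w)‖ = ‖K z w‖ := by
  have h := hK.2.1 ⟨r, hr⟩ z w
  change K (r * z) (r * w) = _ at h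
  rw [h, ← Circle.coe_inv, norm_circle_smul, norm_unitary_rmul, norm_unitary_lmul,
    StarAlgEquiv.norm_map]

theorem Kernels.continuous_comp {K : G → G → A} (hK : K ∈ Kernels D) {Y : Type*}
    [TopologicalSpace Y] {f g : Y → G} (hf : Continuous f) (hg : Continuous g) :
    Continuous fun y => K (f y) (g y) :=
  hK.1.comp (hf.prodMk hg)

/-- Kernels are bounded: up to translation by `N` and up to small values they live on a compact
set. -/
theorem Kernels.exists_bound {K : G → G → A} (hK : K ∈ Kernels D) :
    ∃ M : ℝ, 0 ≤ M ∧ ∀ z w, ‖K z w‖ ≤ M := by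
  obtain ⟨C, hC, hKC⟩ := hK.2.2.1
  obtain ⟨C', hC', hKC'⟩ := hK.2.2.2 1 one_pos
  obtain ⟨M, hM⟩ := (hC'.prod (hC'.mul hC)).exists_bound_of_continuousOn hK.1.continuousOn
  refine ⟨max M 1, by positivity, fun z w => ?_⟩
  by_cases h : 1 ≤ ‖K z w‖
  · obtain ⟨r, hr, c, hc, e⟩ := hKC' (z, w) h
    change z = r * c at e
    have e2 : ‖K z w‖ = ‖K c (r⁻¹ * w)‖ := by
      rw [← Kernels.norm_translate hK hr c, ← e, mul_inv_cancel_left]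
    have h0 : K c (r⁻¹ * w) ≠ 0 := by
      rw [← norm_ne_zero_iff, ← e2]
      positivity
    rw [e2]
    exact (hM (c, r⁻¹ * w) ⟨hc, c, hc, _, hKC _ _ h0, mul_inv_cancel_left _ _⟩).trans
      (le_max_left _ _)
  · exact (not_le.1 h).le.trans (le_max_right _ _)

theorem Kernels.col_mem {K : G → G → A} (hK : K ∈ Kernels D) (w : G) :
    (fun v => K v w) ∈ CompactlySupported G A := by
  obtain ⟨C, hC, hKC⟩ := hK.2.2.1
  refine ⟨Kernels.continuous_comp hK continuous_id continuous_const,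
    HasCompactSupport.intro (hC.image (f := fun c => w * c⁻¹) (by fun_prop)) fun v hv => ?_⟩
  by_contra h
  exact hv ⟨_, hKC _ _ h, by simp⟩

theorem Kernels.row_mem {K : G → G → A} (hK : K ∈ Kernels D) (z : G) :
    (fun v => K z v) ∈ CompactlySupported G A := by
  obtain ⟨C, hC, hKC⟩ := hK.2.2.1
  refine ⟨Kernels.continuous_comp hK continuous_const continuous_id,
    HasCompactSupport.intro (hC.image (f := fun c => z * c) (by fun_prop)) fun v hv => ?_⟩
  by_contra h
  exact hv ⟨_, hKC _ _ h, by simp⟩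

theorem Kernels.integrand_mem {K₁ K₂ : G → G → A} (h₁ : K₁ ∈ Kernels D) (h₂ : K₂ ∈ Kernels D)
    (z w : G) :
    (fun v => (φ z v w : ℂ) • (K₁ z v * K₂ v w)) ∈ CompactlySupported G A := by
  have h := mul_mem_cc (Kernels.row_mem h₁ z).1 (Kernels.col_mem h₂ w)
  exact ⟨(φ.continuous_comp continuous_const continuous_id continuous_const).smul h.1,
    h.2.smul_left⟩

theorem Kernels.star_mem {K : G → G → A} (hK : K ∈ Kernels D) : kerStar K ∈ Kernels D := by
  refine ⟨(hK.1.comp continuous_swap).star, fun r z w => ?_, ?_, fun ε hε => ?_⟩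
  · have h : star ((φ r w z : ℂ)⁻¹) = (φ r z w : ℂ)⁻¹ := by
      rw [φ.swap_right r z w, Circle.coe_inv, inv_inv, ← Circle.coe_inv, Circle.coe_inv_eq_conj]
      rfl
    simp only [kerStar]
    rw [hK.2.1, star_smul, h]
    congr 1
    refine emb_injective ?_
    simp only [emb_star, emb_rmul, emb_lmul, map_star, star_mul, star_coe, inv_inv, mul_assoc]
  · obtain ⟨C, hC, hKC⟩ := hK.2.2.1
    refine ⟨C⁻¹, hC.inv, fun z w h => ?_⟩
    rw [Set.mem_inv, mul_inv_rev, inv_inv]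
    exact hKC w z fun h0 => h (by rw [kerStar, h0, star_zero])
  · obtain ⟨C, hC, hKC⟩ := hK.2.2.1
    obtain ⟨C', hC', h⟩ := hK.2.2.2 ε hε
    refine ⟨C' * C, hC'.mul hC, fun p hp => ?_⟩
    change ε ≤ ‖star (K p.2 p.1)‖ at hp
    rw [norm_star] at hp
    obtain ⟨r, hr, c, hc, e⟩ := h (p.2, p.1) hp
    have h0 : K p.2 p.1 ≠ 0 := by
      rw [← norm_ne_zero_iff]
      exact (hε.trans_le hp).ne'
    refine ⟨r, hr, c * (p.2⁻¹ * p.1), ⟨c, hc, _, hKC _ _ h0, rfl⟩, ?_⟩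
    change p.2 = r * c at e
    rw [← mul_assoc, ← e, mul_inv_cancel_left]

variable [MeasurableSpace G] [BorelSpace G] {μ : Measure G}

theorem Kernels.mul_mem [LocallyCompactSpace G] [μ.IsHaarMeasure] {K₁ K₂ : G → G → A}
    (h₁ : K₁ ∈ Kernels D) (h₂ : K₂ ∈ Kernels D) : kerMul μ φ K₁ K₂ ∈ Kernels D := by
  obtain ⟨C₁, hC₁, hK₁⟩ := h₁.2.2.1
  obtain ⟨C₂, hC₂, hK₂⟩ := h₂.2.2.1
  refine ⟨continuous_iff_continuousAt.2 fun p => ?_, fun r z w => ?_,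
    ⟨C₁ * C₂, hC₁.mul hC₂, fun z w h => ?_⟩, fun ε hε => ?_⟩
  -- for `z` in a compact set `V` the integrand is supported in the compact set `V C₁`
  · obtain ⟨V, hV, hpV⟩ := exists_compact_mem_nhds p.1
    refine ContinuousOn.continuousAt (s := V ×ˢ Set.univ) ?_
      (prod_mem_nhds hpV Filter.univ_mem)
    refine continuousOn_integral_of_compact_support (k := V * C₁) (hV.mul hC₁)
      (Continuous.continuousOn ?_) fun q v hq hv => ?_
    · exact (φ.continuous_comp (by fun_prop) (by fun_prop) (by fun_prop)).smul
        ((Kernels.continuous_comp h₁ (by fun_prop) (by fun_prop)).mul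
          (Kernels.continuous_comp h₂ (by fun_prop) (by fun_prop)))
    · have : K₁ q.1 v = 0 := by
        by_contra h0
        exact hv ⟨q.1, hq.1, _, hK₁ _ _ h0, mul_inv_cancel_left _ _⟩
      rw [this, zero_mul, smul_zero]
  · let L : A →L[ℂ] A := (D.u r w : 𝓜(ℂ, A)).snd.comp
      ((↑(D.u r z)⁻¹ : 𝓜(ℂ, A)).fst.comp (autL (D.α r)))
    have hL (a : A) : ((↑(D.u r z)⁻¹ : 𝓜(ℂ, A)) ▷ D.α r a) ◁ (D.u r w : 𝓜(ℂ, A)) = L a := rfl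
    rw [hL, kerMul, kerMul,
      ← L.integral_comp_comm (integrable_of_mem_cc (Kernels.integrand_mem h₁ h₂ z w)),
      ← integral_smul, ← integral_mul_left_eq_self _ (r : G)]
    refine integral_congr_ae (ae_of_all _ fun y => ?_)
    beta_reduce
    rw [h₁.2.1, h₂.2.1, φ.translate_all, map_smul, smul_mul_smul_comm, smul_smul, smul_smul,
      ← hL]
    congr 1
    · have := Circle.coe_ne_zero (φ r z y)
      have := Circle.coe_ne_zero (φ r y w)
      have := Circle.coe_ne_zero (φ r z w)
      push_cast
      field_simp
    · refine emb_injective ?_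
      simp only [emb_rmul, emb_lmul, emb_mul, map_mul, mul_assoc, mul_inv_cancel_coe]
  · have : ∃ v, (φ z v w : ℂ) • (K₁ z v * K₂ v w) ≠ 0 := by
      by_contra! h0
      exact h (by simp [kerMul, h0])
    obtain ⟨v, hv⟩ := this
    have hv' := right_ne_zero_of_smul hv
    exact ⟨z⁻¹ * v, hK₁ _ _ (left_ne_zero_of_mul hv'), v⁻¹ * w,
      hK₂ _ _ (right_ne_zero_of_mul hv'), by group⟩
  · obtain ⟨M, hM0, hM⟩ := Kernels.exists_bound h₂
    set δ := ε / (M * μ.real C₁ + 1) with hδ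
    have hδ0 : 0 < δ := by positivity
    obtain ⟨C, hC, h⟩ := h₁.2.2.2 δ hδ0
    refine ⟨C, hC, fun p hp => ?_⟩
    by_contra hcon
    have hlt (v : G) : ‖K₁ p.1 v‖ ≤ δ := by
      by_contra hv
      exact hcon (h (p.1, v) (not_le.1 hv).le)
    have h0 (v : G) (hv : v ∉ p.1 • C₁) : (φ p.1 v p.2 : ℂ) • (K₁ p.1 v * K₂ v p.2) = 0 := by
      have : K₁ p.1 v = 0 := by
        by_contra h0
        exact hv ⟨_, hK₁ _ _ h0, mul_inv_cancel_left _ _⟩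
      rw [this, zero_mul, smul_zero]
    have hb : ‖kerMul μ φ K₁ K₂ p.1 p.2‖ ≤ δ * M * μ.real (p.1 • C₁) := by
      rw [kerMul, ← setIntegral_eq_integral_of_forall_compl_eq_zero h0]
      refine norm_setIntegral_le_of_norm_le_const (hC₁.smul p.1).measure_lt_top fun v _ => ?_
      rw [norm_circle_smul]
      exact (norm_mul_le _ _).trans (mul_le_mul (hlt v) (hM _ _) (norm_nonneg _) hδ0.le)
    rw [measureReal_def, measure_smul, ← measureReal_def] at hb
    have : ε = δ * (M * μ.real C₁ + 1) := by
      rw [hδ, div_mul_cancel₀]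
      positivity
    nlinarith

theorem isStarAlgebra_kernels [LocallyCompactSpace G] [μ.IsHaarMeasure] :
    IsStarAlgebra (Kernels D) (kerMul μ φ) kerStar where
  mul_mem _ ha _ hb := Kernels.mul_mem ha hb
  add_mul a ha b hb c hc := by
    ext z w
    simp only [kerMul, Pi.add_apply, add_mul, smul_add]
    exact integral_add (integrable_of_mem_cc (Kernels.integrand_mem ha hc z w))
      (integrable_of_mem_cc (Kernels.integrand_mem hb hc z w))
  mul_add a ha b hb c hc := by
    ext z w
    simp only [kerMul, Pi.add_apply, mul_add, smul_add]
    exact integral_add (integrable_of_mem_cc (Kernels.integrand_mem ha hb z w))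
      (integrable_of_mem_cc (Kernels.integrand_mem ha hc z w))
  smul_mul t a _ b _ := by
    ext z w
    simp only [kerMul, Pi.smul_apply, smul_mul_assoc, smul_comm _ t]
    exact integral_smul _ _
  mul_smul t a _ b _ := by
    ext z w
    simp only [kerMul, Pi.smul_apply, mul_smul_comm, smul_comm _ t]
    exact integral_smul _ _
  inv_mem _ ha := Kernels.star_mem ha
  inv_inv a _ := by
    ext z w
    simp only [kerStar, star_star]
  inv_add a _ b _ := by
    ext z w
    simp only [kerStar, Pi.add_apply, star_add]
  inv_smul t a _ := by
    ext z w
    simp only [kerStar, Pi.smul_apply, star_smul]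
  inv_mul a _ b _ := by
    ext z w
    simp only [kerStar, kerMul]
    rw [← starL'_apply ℝ, ← ContinuousLinearEquiv.integral_comp_comm]
    refine integral_congr_ae (ae_of_all _ fun v => ?_)
    have h : star (φ w v z : ℂ) = φ z v w := by
      have h1 : φ z v w = (φ w v z)⁻¹ := by
        rw [φ.swap_left, φ.swap_right, φ.swap_left, inv_inv]
      rw [h1, Circle.coe_inv_eq_conj]
      rfl
    simp only [starL'_apply, star_smul, star_mul, h]

end KernelAlgebra

/-! ### The norm of the left regular representation on kernels -/

section KernelNorm

variable {G : Type*} [Group G] [TopologicalSpace G] [IsTopologicalGroup G] [T2Space G]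
  {φ : Tricharacter G} {N : Subgroup G} {A : Type*} [NonUnitalCStarAlgebra A]
  {D : TwistedSystem φ N A} [MeasurableSpace G] [BorelSpace G] {μ : Measure G}

theorem kerMul_star_diag (K L : G → G → A) (w : G) :
    kerMul μ φ (kerStar K) L w w = ∫ v, star (K v w) * L v w ∂μ := by
  simp only [kerMul, kerStar, φ.apply_outer, Circle.coe_one, one_smul]

theorem kerL2_eq_iSup (K : G → G → A) :
    kerL2 μ φ K = ⨆ w, ENNReal.ofReal (l2norm μ fun v => K v w) := by
  refine iSup_congr fun w => ?_
  rw [kerMul_star_diag, l2norm, Real.sqrt_eq_rpow,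
    ← ENNReal.ofReal_rpow_of_nonneg (norm_nonneg _) (by norm_num), ofReal_norm]

theorem ofReal_l2norm_le_kerL2 (K : G → G → A) (w : G) :
    ENNReal.ofReal (l2norm μ fun v => K v w) ≤ kerL2 μ φ K := by
  rw [kerL2_eq_iSup]
  exact le_iSup (fun w => ENNReal.ofReal (l2norm μ fun v => K v w)) w

theorem kerL2_sq_le {K : G → G → A} {c : ℝ≥0∞}
    (h : ∀ w, ‖∫ v, star (K v w) * K v w ∂μ‖ₑ ≤ c) : kerL2 μ φ K ^ 2 ≤ c := by
  rw [kerL2_eq_iSup, ENNReal.iSup_pow]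
  refine iSup_le fun w => ?_
  rw [← ENNReal.ofReal_pow (l2norm_nonneg _ _), l2norm_sq, ofReal_norm]
  exact h w

theorem kerL2_smul (c : ℂ) (K : G → G → A) : kerL2 μ φ (c • K) = ‖c‖ₑ * kerL2 μ φ K := by
  rw [kerL2_eq_iSup, kerL2_eq_iSup, ENNReal.mul_iSup]
  refine iSup_congr fun w => ?_
  rw [← ofReal_norm, ← ENNReal.ofReal_mul (norm_nonneg _), ← l2norm_smul]
  rfl

variable [LocallyCompactSpace G] [μ.IsHaarMeasure]

theorem kerL2_add_le {K L : G → G → A} (hK : K ∈ Kernels D) (hL : L ∈ Kernels D) :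
    kerL2 μ φ (K + L) ≤ kerL2 μ φ K + kerL2 μ φ L := by
  rw [kerL2_eq_iSup]
  refine iSup_le fun w => ?_
  refine (ENNReal.ofReal_le_ofReal (l2norm_add_le (Kernels.col_mem hK w)
    (Kernels.col_mem hL w))).trans ?_
  rw [ENNReal.ofReal_add (l2norm_nonneg _ _) (l2norm_nonneg _ _)]
  exact add_le_add (ofReal_l2norm_le_kerL2 K w) (ofReal_l2norm_le_kerL2 L w)

theorem enorm_integral_star_mul_le {K L : G → G → A} (hK : K ∈ Kernels D) (hL : L ∈ Kernels D)
    (w : G) : ‖∫ v, star (K v w) * L v w ∂μ‖ₑ ≤ kerL2 μ φ K * kerL2 μ φ L := by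
  rw [← ofReal_norm]
  refine (ENNReal.ofReal_le_ofReal (norm_integral_star_mul_le (Kernels.col_mem hK w)
    (Kernels.col_mem hL w))).trans ?_
  rw [ENNReal.ofReal_mul (l2norm_nonneg _ _)]
  exact mul_le_mul' (ofReal_l2norm_le_kerL2 K w) (ofReal_l2norm_le_kerL2 L w)

theorem kerL2_ne_top {K : G → G → A} (hK : K ∈ Kernels D) : kerL2 μ φ K ≠ ⊤ := by
  obtain ⟨M, hM0, hM⟩ := Kernels.exists_bound hK
  obtain ⟨C, hC, hKC⟩ := hK.2.2.1
  have h : kerL2 μ φ K ^ 2 ≤ ENNReal.ofReal (M * M * μ.real C⁻¹) := by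
    refine kerL2_sq_le fun w => ?_
    have h0 (v : G) (hv : v ∉ w • C⁻¹) : star (K v w) * K v w = 0 := by
      have : K v w = 0 := by
        by_contra h0
        exact hv ⟨w⁻¹ * v, by simpa using hKC _ _ h0, mul_inv_cancel_left _ _⟩
      rw [this, mul_zero]
    rw [← ofReal_norm, ← setIntegral_eq_integral_of_forall_compl_eq_zero h0]
    refine ENNReal.ofReal_le_ofReal ((norm_setIntegral_le_of_norm_le_const
      (hC.inv.smul w).measure_lt_top fun v _ => ?_).trans_eq
        (by rw [measureReal_def, measure_smul, ← measureReal_def]))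
    rw [CStarRing.norm_star_mul_self]
    exact mul_self_le_mul_self (norm_nonneg _) (hM _ _)
  intro htop
  rw [htop] at h
  simp at h

/-- Left multiplication by a kernel `K` supported in `z⁻¹ w ∈ C` is the integral over `y ∈ C` of the
operators `ξ ↦ (z ↦ φ(z, zy, w) K(z, zy) ξ(zy))`, each of which has norm at most `sup ‖K‖` on
`L²(G, A)` by the right invariance of Haar measure. -/
theorem exists_kerL2_mul_le [μ.IsMulRightInvariant] {K : G → G → A} (hK : K ∈ Kernels D) :
    ∃ c : ℝ≥0∞, c ≠ ⊤ ∧ ∀ L ∈ Kernels D, kerL2 μ φ (kerMul μ φ K L) ≤ c * kerL2 μ φ L := by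
  obtain ⟨M, hM0, hM⟩ := Kernels.exists_bound hK
  obtain ⟨C, hC, hKC⟩ := hK.2.2.1
  refine ⟨ENNReal.ofReal (M * μ.real C), ENNReal.ofReal_ne_top, fun L hL => ?_⟩
  rw [kerL2_eq_iSup]
  refine iSup_le fun w => ?_
  refine le_trans ?_ (mul_le_mul' le_rfl (ofReal_l2norm_le_kerL2 L w))
  rw [← ENNReal.ofReal_mul (by positivity)]
  refine ENNReal.ofReal_le_ofReal ?_
  set T : G → A := fun z => kerMul μ φ K L z w with hT
  have hTm : T ∈ CompactlySupported G A := Kernels.col_mem (Kernels.mul_mem hK hL) w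
  have hLm := Kernels.col_mem hL w
  let S : G → G → A := fun y z => ((φ z (z * y) w : ℂ) • K z (z * y)) * L (z * y) w
  have hS0 (y : G) (hy : y ∉ C) (z : G) : S y z = 0 := by
    have : K z (z * y) = 0 := by
      by_contra h0
      exact hy (by simpa using hKC _ _ h0)
    simp [S, this]
  have hSc : Continuous fun p : G × G => S p.1 p.2 :=
    ((φ.continuous_comp (by fun_prop) (by fun_prop) (by fun_prop)).smul
      (Kernels.continuous_comp hK (by fun_prop) (by fun_prop))).mul
        (hLm.1.comp (f := fun p : G × G => p.2 * p.1) (by fun_prop))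
  have hLy (y : G) : (fun z => L (z * y) w) ∈ CompactlySupported G A :=
    ⟨hLm.1.comp (continuous_mul_const y), hLm.2.comp_homeomorph (Homeomorph.mulRight y)⟩
  have hSm (y : G) : S y ∈ CompactlySupported G A :=
    mul_mem_cc ((φ.continuous_comp continuous_id (continuous_mul_const y) continuous_const).smul
      (Kernels.continuous_comp hK continuous_id (continuous_mul_const y))) (hLy y)
  have hSn (y : G) : l2norm μ (S y) ≤ M * l2norm μ fun v => L v w := by
    refine (l2norm_mul_le hM0 ((φ.continuous_comp continuous_id (continuous_mul_const y)
      continuous_const).smul (Kernels.continuous_comp hK continuous_id (continuous_mul_const y)))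
      (fun z => (norm_circle_smul _ _).trans_le (hM _ _)) (hLy y)).trans_eq ?_
    rw [l2norm, l2norm, integral_mul_right_eq_self (fun z => star (L z w) * L z w) y]
  have hTS (z : G) : T z = ∫ y, S y z ∂μ := by
    rw [hT]
    simp only [kerMul]
    rw [← integral_mul_left_eq_self _ z]
    exact integral_congr_ae (ae_of_all _ fun y => (smul_mul_assoc _ _ _).symm)
  -- `⟪T, T⟫ = ∫ ⟪T, S y⟫ dy` reduces the bound for `T` to the bounds for the operators `S y`
  have hsq : ∫ z, star (T z) * T z ∂μ = ∫ y, ∫ z, star (T z) * S y z ∂μ ∂μ := by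
    have h1 (z : G) : star (T z) * T z = ∫ y, star (T z) * S y z ∂μ := by
      conv_lhs => rw [hTS z]
      rw [← integral_const_mul_of_integrable]
      · rw [hTS z]
      · refine Continuous.integrable_of_hasCompactSupport
          (hSc.comp (f := fun y => (y, z)) (by fun_prop))
          (HasCompactSupport.intro hC fun y hy => hS0 y hy z)
    simp only [h1]
    refine integral_integral_swap_of_hasCompactSupport
      (f := fun z y => star (T z) * S y z) ?_ ?_
    · exact (hTm.1.comp continuous_fst).star.mul
        (hSc.comp (f := fun p : G × G => (p.2, p.1)) (by fun_prop))
    · refine HasCompactSupport.intro (hTm.2.isCompact.prod hC) fun p hp => ?_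
      rw [Set.mem_prod, not_and_or] at hp
      obtain hp | hp := hp
      · simp [Function.uncurry, image_eq_zero_of_notMem_tsupport hp]
      · simp [Function.uncurry, hS0 _ hp]
  have h0 (y : G) (hy : y ∉ C) : ∫ z, star (T z) * S y z ∂μ = 0 := by
    simp [hS0 y hy]
  have hmain : l2norm μ T ^ 2 ≤ l2norm μ T * (M * l2norm μ fun v => L v w) * μ.real C := by
    rw [l2norm_sq, hsq, ← setIntegral_eq_integral_of_forall_compl_eq_zero h0]
    refine norm_setIntegral_le_of_norm_le_const hC.measure_lt_top fun y _ => ?_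
    exact (norm_integral_star_mul_le hTm (hSm y)).trans
      (mul_le_mul_of_nonneg_left (hSn y) (l2norm_nonneg _ _))
  obtain h | h := (l2norm_nonneg μ T).eq_or_lt
  · rw [← h]
    exact mul_nonneg (by positivity) (l2norm_nonneg _ _)
  · refine le_of_mul_le_mul_left ?_ h
    linarith

/-- The operators of left multiplication by `K*` and by `K` are adjoint to each other. -/
theorem integral_star_kerStar_mul {K L L' : G → G → A} (hK : K ∈ Kernels D) (hL : L ∈ Kernels D)
    (hL' : L' ∈ Kernels D) (w : G) :
    ∫ z, star (kerMul μ φ (kerStar K) L z w) * L' z w ∂μ =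
      ∫ v, star (L v w) * kerMul μ φ K L' v w ∂μ := by
  have hLm := Kernels.col_mem hL w
  have hLm' := Kernels.col_mem hL' w
  let f : G → G → A := fun z v => (φ v z w : ℂ) • (star (L v w) * (K v z * L' z w))
  have hf (z : G) : star (kerMul μ φ (kerStar K) L z w) * L' z w = ∫ v, f z v ∂μ := by
    have hi := star_mem_cc (Kernels.integrand_mem (φ := φ) (Kernels.star_mem hK) hL z w)
    rw [kerMul, ← starL'_apply ℝ, ← ContinuousLinearEquiv.integral_comp_comm,
      ← integral_mul_const_of_integrable (f := fun x => starL' ℝ _) (integrable_of_mem_cc hi)]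
    refine integral_congr_ae (ae_of_all _ fun v => ?_)
    have h : star (φ z v w : ℂ) = φ v z w := by
      rw [φ.swap_left, Circle.coe_inv_eq_conj]
      exact star_star (φ v z w : ℂ)
    simp only [starL'_apply, kerStar, star_smul, star_mul, star_star, h, smul_mul_assoc, mul_assoc,
      f]
  have hf' (v : G) : star (L v w) * kerMul μ φ K L' v w = ∫ z, f z v ∂μ := by
    rw [kerMul, ← integral_const_mul_of_integrable
      (integrable_of_mem_cc (Kernels.integrand_mem hK hL' v w))]
    simp only [mul_smul_comm, f]
  simp only [hf, hf']
  refine integral_integral_swap_of_hasCompactSupport ?_ ?_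
  · exact (φ.continuous_comp (by fun_prop) (by fun_prop) (by fun_prop)).smul
      ((hLm.1.comp continuous_snd).star.mul
        ((Kernels.continuous_comp hK (by fun_prop) (by fun_prop)).mul (hLm'.1.comp continuous_fst)))
  · refine HasCompactSupport.intro (hLm'.2.isCompact.prod hLm.2.isCompact) fun p hp => ?_
    rw [Set.mem_prod, not_and_or] at hp
    obtain hp | hp := hp
    · have : L' p.1 w = 0 := image_eq_zero_of_notMem_tsupport (f := fun v => L' v w) hp
      simp [Function.uncurry, f, this]
    · have : L p.2 w = 0 := image_eq_zero_of_notMem_tsupport (f := fun v => L v w) hp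
      simp [Function.uncurry, f, this]

theorem kerNorm_le {K : G → G → A} {c : ℝ≥0∞}
    (h : ∀ L ∈ Kernels D, kerL2 μ φ L ≤ 1 → kerL2 μ φ (kerMul μ φ K L) ≤ c) :
    kerNorm μ D K ≤ c :=
  iSup₂_le fun L hL => h L hL.1 hL.2

theorem kerL2_mul_le_kerNorm (K : G → G → A) {L : G → G → A} (hL : L ∈ Kernels D)
    (h : kerL2 μ φ L ≤ 1) : kerL2 μ φ (kerMul μ φ K L) ≤ kerNorm μ D K :=
  le_iSup₂ (f := fun (K' : G → G → A) (_ : K' ∈ {K' ∈ Kernels D | kerL2 μ φ K' ≤ 1}) =>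
    kerL2 μ φ (kerMul μ φ K K')) L ⟨hL, h⟩

variable [μ.IsMulRightInvariant]

theorem kerNorm_ne_top {K : G → G → A} (hK : K ∈ Kernels D) : kerNorm μ D K ≠ ⊤ := by
  obtain ⟨c, hc, h⟩ := exists_kerL2_mul_le (μ := μ) hK
  refine ne_top_of_le_ne_top hc (kerNorm_le fun L hL hL1 => (h L hL).trans ?_)
  exact (mul_le_mul' le_rfl hL1).trans_eq (mul_one c)

/-- By homogeneity, the norm of `K` bounds left multiplication by `K` on all kernels. If `‖L‖₂ = 0`,
where no rescaling is possible, the claim rests on the boundedness of left multiplication. -/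
theorem kerL2_mul_le {K L : G → G → A} (hK : K ∈ Kernels D) (hL : L ∈ Kernels D) :
    kerL2 μ φ (kerMul μ φ K L) ≤ kerNorm μ D K * kerL2 μ φ L := by
  by_cases h0 : kerL2 μ φ L = 0
  · obtain ⟨c, -, h⟩ := exists_kerL2_mul_le (μ := μ) hK
    simpa [h0] using h L hL
  · have htop := kerL2_ne_top (μ := μ) hL
    set t : ℝ := (kerL2 μ φ L).toReal with ht
    have ht0 : 0 < t := ENNReal.toReal_pos h0 htop
    have hLt : kerL2 μ φ L = ENNReal.ofReal t := (ENNReal.ofReal_toReal htop).symm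
    have ht1 : ‖((t⁻¹ : ℝ) : ℂ)‖ₑ = (ENNReal.ofReal t)⁻¹ := by
      rw [← ofReal_norm, Complex.norm_real, Real.norm_of_nonneg (by positivity),
        ENNReal.ofReal_inv_of_pos ht0]
    have h := kerL2_mul_le_kerNorm (μ := μ) K ((Kernels D).smul_mem ((t⁻¹ : ℝ) : ℂ) hL) (by
      rw [kerL2_smul, ht1, hLt, ENNReal.inv_mul_cancel (by simpa using ht0) ENNReal.ofReal_ne_top])
    rw [(isStarAlgebra_kernels (μ := μ)).mul_smul _ K hK L hL, kerL2_smul, ht1, mul_comm,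
      ← div_eq_mul_inv] at h
    rw [hLt]
    exact (ENNReal.div_le_iff (by simpa using ht0) ENNReal.ofReal_ne_top).1 h

/-- Writing `T = K* ⋆ L` with `‖L‖₂ ≤ 1`, adjointness and the Cauchy–Schwarz inequality give
`‖T‖₂² ≤ ‖L‖₂ ‖K ⋆ T‖₂ ≤ ‖K‖ ‖T‖₂`. Only kernels occur here, and associativity is not needed. -/
theorem kerNorm_star_le {K : G → G → A} (hK : K ∈ Kernels D) :
    kerNorm μ D (kerStar K) ≤ kerNorm μ D K := by
  refine kerNorm_le fun L hL hL1 => ?_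
  set T := kerMul μ φ (kerStar K) L with hT
  have hTm : T ∈ Kernels D := Kernels.mul_mem (Kernels.star_mem hK) hL
  have h : kerL2 μ φ T ^ 2 ≤ kerNorm μ D K * kerL2 μ φ T := by
    refine kerL2_sq_le fun w => ?_
    rw [hT, integral_star_kerStar_mul hK hL hTm, ← hT]
    refine (enorm_integral_star_mul_le hL (Kernels.mul_mem hK hTm) w).trans ?_
    refine (mul_le_mul' hL1 (kerL2_mul_le hK hTm)).trans_eq (one_mul _)
  by_cases h0 : kerL2 μ φ T = 0
  · rw [h0]
    exact zero_le
  · rw [pow_two] at h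
    exact (ENNReal.mul_le_mul_iff_left h0 (kerL2_ne_top hTm)).1 h

theorem kerNorm_star {K : G → G → A} (hK : K ∈ Kernels D) :
    kerNorm μ D (kerStar K) = kerNorm μ D K := by
  refine (kerNorm_star_le hK).antisymm ?_
  have h := kerNorm_star_le (μ := μ) (Kernels.star_mem hK)
  rwa [(isStarAlgebra_kernels (μ := μ)).inv_inv K hK] at h

theorem kerNorm_add_le {K L : G → G → A} (hK : K ∈ Kernels D) (hL : L ∈ Kernels D) :
    kerNorm μ D (K + L) ≤ kerNorm μ D K + kerNorm μ D L := by
  refine kerNorm_le fun T hT hT1 => ?_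
  rw [(isStarAlgebra_kernels (μ := μ)).add_mul K hK L hL T hT]
  exact (kerL2_add_le (Kernels.mul_mem hK hT) (Kernels.mul_mem hL hT)).trans
    (add_le_add (kerL2_mul_le_kerNorm K hT hT1) (kerL2_mul_le_kerNorm L hT hT1))

theorem kerNorm_smul (c : ℂ) {K : G → G → A} (hK : K ∈ Kernels D) :
    kerNorm μ D (c • K) = ‖c‖ₑ * kerNorm μ D K := by
  rw [kerNorm, kerNorm]
  simp only [ENNReal.mul_iSup]
  refine iSup_congr fun T => iSup_congr fun hT => ?_
  rw [(isStarAlgebra_kernels (μ := μ)).smul_mul c K hK T hT.1, kerL2_smul]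

/-- If left multiplication by `K` vanishes, then so does
`(K ⋆ K*)(z, z) = ∫ K(z, v) K(z, v)* dv`. -/
theorem eq_zero_of_kerNorm_eq_zero {K : G → G → A} (hK : K ∈ Kernels D)
    (h : kerNorm μ D K = 0) : K = 0 := by
  have hS := Kernels.star_mem hK
  have hKS := Kernels.mul_mem (μ := μ) hK hS
  have h0 : kerL2 μ φ (kerMul μ φ K (kerStar K)) = 0 := by
    simpa [h] using kerL2_mul_le (μ := μ) hK hS
  ext z w
  have h1 : kerMul μ φ K (kerStar K) z z = 0 := by
    refine l2norm_eq_zero (μ := μ) (Kernels.col_mem hKS z) ?_ z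
    have h2 := ofReal_l2norm_le_kerL2 (μ := μ) (φ := φ) (kerMul μ φ K (kerStar K)) z
    rw [h0, nonpos_iff_eq_zero, ENNReal.ofReal_eq_zero] at h2
    exact h2.antisymm (l2norm_nonneg _ _)
  have h3 : star (K z w) = 0 := by
    refine l2norm_eq_zero (μ := μ) (Kernels.col_mem hS z) ?_ w
    have h4 := kerMul_star_diag (μ := μ) (φ := φ) (kerStar K) (kerStar K) z
    have h5 : kerStar (kerStar K) = K := (isStarAlgebra_kernels (μ := μ)).inv_inv K hK
    rw [h5, h1] at h4
    rw [l2norm, ← h4, norm_zero, Real.sqrt_zero]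
  simpa using h3

end KernelNorm

/-! ### The kernel of a function with values in the induced algebra -/

section Induced

variable {G : Type*} [Group G] [TopologicalSpace G] [IsTopologicalGroup G] [T2Space G]
  {φ : Tricharacter G} {N : Subgroup G} {A : Type*} [NonUnitalCStarAlgebra A]
  {D : TwistedSystem φ N A}

theorem norm_induced_translate (f : induced D) {r : G} (hr : r ∈ N) (x : G) :
    ‖f.1 (r * x)‖ = ‖f.1 x‖ := by
  have h := f.2.1 ⟨r, hr⟩ x
  change f.1 (r * x) = _ at h
  rw [h, norm_ad, StarAlgEquiv.norm_map]

/-- A family of elements of `u-ind_N^G(A)` that is jointly continuous as a function with values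
in `A` and that vanishes at infinity on `N \ G` uniformly in the parameter is continuous for the
supremum norm. -/
theorem continuous_of_vanishesModulo {Y : Type*} [TopologicalSpace Y] {H : Y → induced D}
    (hH : Continuous fun p : Y × G => (H p.1).1 p.2)
    (hv : VanishesModulo N Prod.snd fun p : Y × G => (H p.1).1 p.2) : Continuous H := by
  rw [continuous_iff_continuousAt]
  intro y₀
  refine Metric.tendsto_nhds.2 fun ε hε => ?_
  obtain ⟨C, hC, h⟩ := hv (ε / 4) (by positivity)
  have h1 : ∀ᶠ y in 𝓝 y₀, ∀ c ∈ C, ‖(H y).1 c - (H y₀).1 c‖ < ε / 2 := by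
    refine hC.eventually_forall_of_forall_eventually fun c _ => ?_
    have h2 : Continuous fun p : Y × G => ‖(H p.1).1 p.2 - (H y₀).1 p.2‖ :=
      (hH.sub ((H y₀).1.continuous.comp continuous_snd)).norm
    exact h2.continuousAt.eventually_lt continuousAt_const (by simpa using half_pos hε)
  filter_upwards [h1] with y hy
  rw [dist_eq_norm]
  refine lt_of_le_of_lt ?_ (half_lt_self hε)
  refine (BoundedContinuousFunction.norm_le (half_pos hε).le).2 fun x => ?_
  by_cases hx : ∃ r ∈ N, ∃ c ∈ C, x = r * c
  · obtain ⟨r, hr, c, hc, rfl⟩ := hx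
    have h3 := norm_induced_translate (H y - H y₀) hr c
    exact h3.trans_le (hy c hc).le
  · have h4 (y : Y) : ‖(H y).1 x‖ < ε / 4 := by
      by_contra h5
      exact hx (h (y, x) (not_lt.1 h5))
    refine (norm_sub_le ((H y).1 x) ((H y₀).1 x)).trans ?_
    linarith [h4 y, h4 y₀]

theorem continuous_induced_eval {Y : Type*} [TopologicalSpace Y] {F : G → induced D}
    (hF : Continuous F) {f g : Y → G} (hf : Continuous f) (hg : Continuous g) :
    Continuous fun y => (F (f y)).1 (g y) :=
  (continuous_subtype_val.comp (hF.comp hf)).eval hg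

/-- A continuous compactly supported function with values in `u-ind_N^G(A)` has a compact image,
so its values vanish at infinity on `N \ G` uniformly. -/
theorem vanishesModulo_of_mem_cc {F : G → induced D} (hF : F ∈ CompactlySupported G (induced D)) :
    VanishesModulo N Prod.snd fun p : G × G => (F p.1).1 p.2 := by
  intro ε hε
  have h : ∃ C : Set G, IsCompact C ∧ ∀ x ∈ tsupport F, ∀ z, ε ≤ ‖(F x).1 z‖ →
      ∃ r ∈ N, ∃ c ∈ C, z = r * c := by
    refine hF.2.isCompact.induction_on (p := fun s => ∃ C : Set G, IsCompact C ∧ ∀ x ∈ s, ∀ z,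
      ε ≤ ‖(F x).1 z‖ → ∃ r ∈ N, ∃ c ∈ C, z = r * c) ⟨∅, isCompact_empty, by simp⟩ ?_ ?_ ?_
    · rintro s t hst ⟨C, hC, h⟩
      exact ⟨C, hC, fun x hx => h x (hst hx)⟩
    · rintro s t ⟨C, hC, h⟩ ⟨C', hC', h'⟩
      refine ⟨C ∪ C', hC.union hC', ?_⟩
      rintro x (hx | hx) z hz
      · obtain ⟨r, hr, c, hc, e⟩ := h x hx z hz
        exact ⟨r, hr, c, Or.inl hc, e⟩
      · obtain ⟨r, hr, c, hc, e⟩ := h' x hx z hz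
        exact ⟨r, hr, c, Or.inr hc, e⟩
    · intro x₀ _
      obtain ⟨C, hC, h⟩ := (F x₀).2.2 (ε / 2) (half_pos hε)
      refine ⟨_, mem_nhdsWithin_of_mem_nhds (hF.1.continuousAt.preimage_mem_nhds
        (Metric.ball_mem_nhds _ (half_pos hε))), C, hC, fun x hx z hz => h z ?_⟩
      rw [Set.mem_preimage, Metric.mem_ball, dist_eq_norm] at hx
      have h1 : ‖(F x).1 z - (F x₀).1 z‖ < ε / 2 :=
        ((F x - F x₀).1.norm_coe_le_norm z).trans_lt hx
      have h2 := norm_sub_norm_le ((F x).1 z) ((F x₀).1 z)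
      linarith
  obtain ⟨C, hC, h⟩ := h
  refine ⟨C, hC, fun p hp => h p.1 ?_ p.2 hp⟩
  by_contra h0
  have h1 : ε ≤ ‖(F p.1).1 p.2‖ := hp
  rw [image_eq_zero_of_notMem_tsupport h0] at h1
  have : ε ≤ ‖(0 : A)‖ := h1
  rw [norm_zero] at this
  linarith

theorem norm_apply_le_of_mem_cc {F : G → induced D} (hF : F ∈ CompactlySupported G (induced D)) :
    ∃ M : ℝ, 0 < M ∧ ∀ x z, ‖(F x).1 z‖ ≤ M := by
  obtain ⟨M, hM⟩ := hF.2.exists_bound_of_continuous hF.1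
  exact ⟨max M 1, by positivity, fun x z =>
    (((F x).1.norm_coe_le_norm z).trans (hM x)).trans (le_max_left _ _)⟩

theorem rmul_rmul (a : A) (m n : 𝓜(ℂ, A)) : a ◁ m ◁ n = a ◁ (m * n) := rfl

theorem rmul_one (a : A) : a ◁ (1 : 𝓜(ℂ, A)) = a := rfl

theorem rmul_smul (a : A) (c : ℂ) (m : 𝓜(ℂ, A)) : a ◁ (c • m) = c • (a ◁ m) := rfl

theorem smul_rmul (c : ℂ) (a : A) (m : 𝓜(ℂ, A)) : (c • a) ◁ m = c • (a ◁ m) :=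
  map_smul m.snd c a

theorem inv_lmul_star (w : unitary 𝓜(ℂ, A)) (a : A) :
    (↑w⁻¹ : 𝓜(ℂ, A)) ▷ star a = star (a ◁ (w : 𝓜(ℂ, A))) := by
  rw [star_rmul_unitary, star_star]

variable (D) in
/-- The kernel `(z, w) ↦ F(z⁻¹w)(z) u(z, z⁻¹w)` of a function `F` on `G` with values in
`u-ind_N^G(A)`. -/
def toKer : (G → induced D) →ₗ[ℂ] (G → G → A) where
  toFun F z w := (F (z⁻¹ * w)).1 z ◁ (D.u z (z⁻¹ * w) : 𝓜(ℂ, A))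
  map_add' _ _ := funext fun z => funext fun w => map_add (D.u z (z⁻¹ * w) : 𝓜(ℂ, A)).snd _ _
  map_smul' c _ := funext fun z => funext fun w => map_smul (D.u z (z⁻¹ * w) : 𝓜(ℂ, A)).snd c _

theorem toKer_apply (F : G → induced D) (z w : G) :
    toKer D F z w = (F (z⁻¹ * w)).1 z ◁ (D.u z (z⁻¹ * w) : 𝓜(ℂ, A)) := rfl

theorem toKer_apply_mul (F : G → induced D) (z x : G) :
    toKer D F z (z * x) = (F x).1 z ◁ (D.u z x : 𝓜(ℂ, A)) := by
  rw [toKer_apply, inv_mul_cancel_left]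

theorem apply_eq_toKer (F : G → induced D) (x z : G) :
    (F x).1 z = toKer D F z (z * x) ◁ (↑(D.u z x)⁻¹ : 𝓜(ℂ, A)) := by
  rw [toKer_apply_mul, rmul_rmul, coe_mul_inv, rmul_one]

theorem toKer_injective : Function.Injective (toKer D) := fun F F' h =>
  funext fun x => Subtype.ext (BoundedContinuousFunction.ext fun z => by
    rw [apply_eq_toKer, apply_eq_toKer, h])

theorem toKer_mem {F : G → induced D} (hF : F ∈ CompactlySupported G (induced D)) :
    toKer D F ∈ Kernels D := by
  refine ⟨?_, fun r z w => ?_, ⟨tsupport F, hF.2.isCompact, fun z w h => ?_⟩, fun ε hε => ?_⟩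
  · exact (D.u_continuous.comp (f := fun p : G × G => (p.1, p.1⁻¹ * p.2)) (by fun_prop)).rmul
      (continuous_induced_eval hF.1 (by fun_prop) (by fun_prop))
  · obtain ⟨x, rfl⟩ : ∃ x, w = z * x := ⟨z⁻¹ * w, (mul_inv_cancel_left _ _).symm⟩
    have hφ : φ r z (z * x) = φ r z x := by
      rw [φ.mul_right, φ.swap_left, φ.apply_outer, inv_one, one_mul]
    rw [← mul_assoc, toKer_apply_mul, toKer_apply_mul, rmul_extend, (F x).2.1, hφ]
    have h : extend (D.α r) (D.u z x) = (extendU (D.α r) (D.u z x) : 𝓜(ℂ, A)) := rfl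
    have e (c : ℂ) (b : A) : emb (c • b) = c • emb b := map_smul _ c b
    refine emb_injective ?_
    rw [h, D.cocycleU, coe_scal_mul, ← Circle.coe_inv, e, emb_rmul, emb_rmul, emb_lmul, emb_rmul,
      emb_ad, inv_inv]
    simp only [Submonoid.coe_mul, mul_smul_comm, smul_mul_assoc, smul_smul, ← Circle.coe_mul,
      inv_mul_cancel, Circle.coe_one, one_smul, mul_assoc, inv_mul_coe, mul_one]
  · by_contra h0
    refine h ?_
    rw [toKer_apply, image_eq_zero_of_notMem_tsupport h0]
    exact map_zero (D.u z (z⁻¹ * w) : 𝓜(ℂ, A)).snd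
  · obtain ⟨C, hC, h⟩ := vanishesModulo_of_mem_cc hF ε hε
    refine ⟨C, hC, fun p hp => h (p.1⁻¹ * p.2, p.1) ?_⟩
    change ε ≤ ‖toKer D F p.1 p.2‖ at hp
    rwa [toKer_apply, norm_unitary_rmul] at hp

/-- The inverse of `toKer` is `K ↦ (x ↦ (z ↦ K(z, zx) u(z, x)⁻¹))`. The cocycle identity makes these
functions equivariant, and the decay of `K` modulo `N` makes them depend on `x` continuously for
the supremum norm. -/
theorem exists_toKer_eq {K : G → G → A} (hK : K ∈ Kernels D) :
    ∃ F ∈ CompactlySupported G (induced D), toKer D F = K := by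
  obtain ⟨M, hM0, hM⟩ := Kernels.exists_bound hK
  obtain ⟨C, hC, hKC⟩ := hK.2.2.1
  have hc : Continuous fun p : G × G => K p.2 (p.2 * p.1) ◁ (↑(D.u p.2 p.1)⁻¹ : 𝓜(ℂ, A)) :=
    (StrictlyContinuous.inv (w := fun p : G × G => D.u p.2 p.1)
      (D.u_continuous.comp continuous_swap)).rmul
        (Kernels.continuous_comp hK (by fun_prop) (by fun_prop))
  have hv (ε : ℝ) (hε : ε > 0) : ∃ C : Set G, IsCompact C ∧ ∀ x z : G,
      ε ≤ ‖K z (z * x) ◁ (↑(D.u z x)⁻¹ : 𝓜(ℂ, A))‖ → ∃ r ∈ N, ∃ c ∈ C, z = r * c := by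
    obtain ⟨C, hC, h⟩ := hK.2.2.2 ε hε
    refine ⟨C, hC, fun x z hz => h (z, z * x) ?_⟩
    rwa [norm_unitary_rmul] at hz
  let F (x : G) : induced D :=
    ⟨BoundedContinuousFunction.ofNormedAddCommGroup
      (fun z => K z (z * x) ◁ (↑(D.u z x)⁻¹ : 𝓜(ℂ, A)))
      (hc.comp (f := fun z => (x, z)) (by fun_prop)) M
      (fun z => by rw [norm_unitary_rmul]; exact hM _ _), by
      refine ⟨fun r z => ?_, fun ε hε => ?_⟩
      · change K (r * z) (r * z * x) ◁ (↑(D.u (r * z) x)⁻¹ : 𝓜(ℂ, A)) =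
          ad (D.u r z)⁻¹ (D.α r (K z (z * x) ◁ (↑(D.u z x)⁻¹ : 𝓜(ℂ, A))))
        have hφ : φ r z (z * x) = φ r z x := by
          rw [φ.mul_right, φ.swap_left, φ.apply_outer, inv_one, one_mul]
        have h : extend (D.α r) (↑(D.u z x)⁻¹ : 𝓜(ℂ, A)) =
          (↑(extendU (D.α r) (D.u z x)⁻¹) : 𝓜(ℂ, A)) := rfl
        have e (c : ℂ) (b : A) : emb (c • b) = c • emb b := map_smul _ c b
        refine emb_injective ?_
        rw [rmul_extend, h, extendU_inv, D.cocycleU, scal_mul_inv, coe_scal_mul, mul_assoc,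
          hK.2.1, hφ, emb_ad, emb_rmul, emb_rmul, e, emb_rmul, emb_lmul]
        simp only [mul_inv_rev, inv_inv, Submonoid.coe_mul, mul_smul_comm, smul_mul_assoc,
          mul_assoc, inv_mul_coe, mul_one, Circle.coe_inv]
      · obtain ⟨C, hC, h⟩ := hv ε hε
        exact ⟨C, hC, fun z hz => h x z hz⟩⟩
  refine ⟨F, ⟨continuous_of_vanishesModulo hc fun ε hε => ?_,
    HasCompactSupport.intro hC fun x hx => ?_⟩, ?_⟩
  · obtain ⟨C, hC, h⟩ := hv ε hε
    exact ⟨C, hC, fun p hp => h p.1 p.2 hp⟩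
  · refine Subtype.ext (BoundedContinuousFunction.ext fun z => ?_)
    change K z (z * x) ◁ (↑(D.u z x)⁻¹ : 𝓜(ℂ, A)) = 0
    have h0 : K z (z * x) = 0 := by
      by_contra h0
      exact hx (by simpa using hKC _ _ h0)
    rw [h0]
    exact map_zero (↑(D.u z x)⁻¹ : 𝓜(ℂ, A)).snd
  · ext z w
    obtain ⟨x, rfl⟩ : ∃ x, w = z * x := ⟨z⁻¹ * w, (mul_inv_cancel_left _ _).symm⟩
    rw [toKer_apply_mul]
    change K z (z * x) ◁ (↑(D.u z x)⁻¹ : 𝓜(ℂ, A)) ◁ (D.u z x : 𝓜(ℂ, A)) = _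
    rw [rmul_rmul, inv_mul_coe, rmul_one]

theorem toKer_mem_iff {F : G → induced D} :
    toKer D F ∈ Kernels D ↔ F ∈ CompactlySupported G (induced D) := by
  refine ⟨fun h => ?_, toKer_mem⟩
  obtain ⟨F', hF', h'⟩ := exists_toKer_eq h
  rwa [← toKer_injective h']

theorem toKer_convStar (F : G → induced D) :
    toKer D (convStar (beta D) (v D) F) = kerStar (toKer D F) := by
  ext z w
  obtain ⟨x, rfl⟩ : ∃ x, w = z * x := ⟨z⁻¹ * w, (mul_inv_cancel_left _ _).symm⟩
  have hφ : φ z x x⁻¹ = 1 := by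
    have h := φ.mul_right z x x x⁻¹
    rw [mul_inv_cancel, φ.swap_left x z x, φ.apply_outer, inv_one, one_mul] at h
    rw [← h]
    have h1 := φ.mul_right z x 1 1
    rw [one_mul] at h1
    exact left_eq_mul.1 h1
  have hv : (convStar (beta D) (v D) F x).1 z =
      (↑(vFun D x x⁻¹ z)⁻¹ : 𝓜(ℂ, A)) ▷ star (ad (D.u z x) ((F x⁻¹).1 (z * x))) := by
    rw [convStar, inv_lmul_star, inv_lmul_star]
    rfl
  have hu : D.u (z * x) ((z * x)⁻¹ * z) = D.u (z * x) x⁻¹ := by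
    rw [mul_inv_rev, inv_mul_cancel_right]
  rw [toKer_apply_mul, hv, kerStar, toKer_apply, hu, mul_inv_rev, inv_mul_cancel_right, vFun, hφ,
    scal_one, one_mul, mul_inv_cancel, D.u_one_right]
  refine emb_injective ?_
  simp only [emb_rmul, emb_lmul, emb_star, emb_ad, star_mul, star_coe, inv_inv, mul_inv_rev,
    inv_one, Submonoid.coe_mul, mul_assoc, inv_mul_coe, mul_one, inv_mul_cancel_coe]

variable [MeasurableSpace G] [BorelSpace G] {μ : Measure G}

/-- The integrand of the twisted convolution is continuous for the norm of `u-ind_N^G(A)`, so the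
convolution integral exists there and can be evaluated pointwise. -/
theorem conv_integrand_mem {F₁ F₂ : G → induced D}
    (h₁ : F₁ ∈ CompactlySupported G (induced D)) (h₂ : F₂ ∈ CompactlySupported G (induced D))
    (x : G) : (fun y => (F₁ y * beta D y (F₂ (y⁻¹ * x))) ◁
      (v D y (y⁻¹ * x) : 𝓜(ℂ, induced D))) ∈ CompactlySupported G (induced D) := by
  refine ⟨continuous_of_vanishesModulo ?_ fun ε hε => ?_,
    HasCompactSupport.intro h₁.2.isCompact fun y hy => ?_⟩
  -- joint continuity: the multipliers `u` are only strictly continuous, so they are applied in turn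
  · have e (c : Circle) (a : A) (w : unitary 𝓜(ℂ, A)) :
        a ◁ ((scal c * w : unitary 𝓜(ℂ, A)) : 𝓜(ℂ, A)) = (c : ℂ) • (a ◁ (w : 𝓜(ℂ, A))) := by
      rw [coe_scal_mul, rmul_smul]
    have h : ∀ p : G × G, ((F₁ p.1 * beta D p.1 (F₂ (p.1⁻¹ * x))) ◁
        (v D p.1 (p.1⁻¹ * x) : 𝓜(ℂ, induced D))).1 p.2 = (φ p.2 p.1 (p.1⁻¹ * x) : ℂ) •
          (((F₁ p.1).1 p.2 * ad (D.u p.2 p.1) ((F₂ (p.1⁻¹ * x)).1 (p.2 * p.1))) ◁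
          (D.u p.2 p.1 : 𝓜(ℂ, A)) ◁ (D.u (p.2 * p.1) (p.1⁻¹ * x) : 𝓜(ℂ, A)) ◁
          (↑(D.u p.2 (p.1 * (p.1⁻¹ * x)))⁻¹ : 𝓜(ℂ, A))) := fun p => by
      rw [v_rmul, vFun, e]
      rfl
    simp only [h]
    have hu : StrictlyContinuous fun p : G × G => (D.u p.2 p.1 : 𝓜(ℂ, A)) :=
      D.u_continuous.comp continuous_swap
    refine (φ.continuous_comp (by fun_prop) (by fun_prop) (by fun_prop)).smul
      (StrictlyContinuous.rmul (StrictlyContinuous.inv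
        (w := fun p : G × G => D.u p.2 (p.1 * (p.1⁻¹ * x)))
        (D.u_continuous.comp (f := fun p : G × G => (p.2, p.1 * (p.1⁻¹ * x))) (by fun_prop)))
      (StrictlyContinuous.rmul (D.u_continuous.comp
        (f := fun p : G × G => (p.2 * p.1, p.1⁻¹ * x)) (by fun_prop))
      (hu.rmul ((continuous_induced_eval h₁.1 continuous_fst continuous_snd).mul
        (hu.ad (continuous_induced_eval h₂.1 (by fun_prop) (by fun_prop)))))))
  · obtain ⟨M, hM0, hM⟩ := norm_apply_le_of_mem_cc h₂
    obtain ⟨C, hC, h⟩ := vanishesModulo_of_mem_cc h₁ (ε / M) (by positivity)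
    refine ⟨C, hC, fun p hp => h p ?_⟩
    change ε ≤ ‖((F₁ p.1 * beta D p.1 (F₂ (p.1⁻¹ * x))) ◁
      (v D p.1 (p.1⁻¹ * x) : 𝓜(ℂ, induced D))).1 p.2‖ at hp
    rw [v_rmul, norm_unitary_rmul] at hp
    rw [div_le_iff₀ hM0]
    refine hp.trans ((norm_mul_le ((F₁ p.1).1 p.2) _).trans ?_)
    refine mul_le_mul_of_nonneg_left ?_ (norm_nonneg _)
    rw [beta_apply, norm_ad]
    exact hM _ _
  · rw [image_eq_zero_of_notMem_tsupport hy, zero_mul]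
    exact map_zero (v D y (y⁻¹ * x) : 𝓜(ℂ, induced D)).snd

variable (D) in
/-- Evaluation at `z`, as a continuous linear map on `u-ind_N^G(A)`. -/
def evalL (z : G) : induced D →L[ℂ] A :=
  LinearMap.mkContinuous
    { toFun := fun f => f.1 z
      map_add' := fun _ _ => rfl
      map_smul' := fun _ _ => rfl } 1
    (fun f => by rw [one_mul]; exact f.1.norm_coe_le_norm z)

/-- After the substitution `v = zy` the two integrands agree, since `φ(z, zy, zx) = φ(z, y, x)` and
`φ(z, y, y⁻¹x) = φ(z, y, x)`. -/
theorem toKer_conv [μ.IsHaarMeasure] {F₁ F₂ : G → induced D}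
    (h₁ : F₁ ∈ CompactlySupported G (induced D)) (h₂ : F₂ ∈ CompactlySupported G (induced D)) :
    toKer D (conv μ (beta D) (v D) F₁ F₂) = kerMul μ φ (toKer D F₁) (toKer D F₂) := by
  ext z w
  obtain ⟨x, rfl⟩ : ∃ x, w = z * x := ⟨z⁻¹ * w, (mul_inv_cancel_left _ _).symm⟩
  let L : induced D →L[ℂ] A := (D.u z x : 𝓜(ℂ, A)).snd.comp (evalL D z)
  have hL (f : induced D) : L f = f.1 z ◁ (D.u z x : 𝓜(ℂ, A)) := rfl
  rw [toKer_apply_mul, ← hL, conv, ← L.integral_comp_comm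
    (integrable_of_mem_cc (conv_integrand_mem h₁ h₂ x)), kerMul,
    ← integral_mul_left_eq_self (fun y => (φ z y (z * x) : ℂ) •
      (toKer D F₁ z y * toKer D F₂ y (z * x))) z]
  refine integral_congr_ae (ae_of_all _ fun y => ?_)
  have hφ : φ z (z * y) (z * x) = φ z y x := by
    rw [φ.mul_mid, φ.diag, one_mul, φ.mul_right, φ.apply_outer, one_mul]
  have hφ' : φ z y (y⁻¹ * x) = φ z y x := by
    have h := φ.mul_right z y y (y⁻¹ * x)
    rw [mul_inv_cancel_left, φ.swap_left y z y, φ.apply_outer, inv_one, one_mul] at h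
    exact h.symm
  have hx : toKer D F₂ (z * y) (z * x) =
      (F₂ (y⁻¹ * x)).1 (z * y) ◁ (D.u (z * y) (y⁻¹ * x) : 𝓜(ℂ, A)) := by
    rw [← toKer_apply_mul, mul_assoc, mul_inv_cancel_left]
  beta_reduce
  rw [hL, v_rmul, hφ, toKer_apply_mul, hx, vFun, hφ', coe_scal_mul, rmul_smul]
  change ((φ z y x : ℂ) • (((F₁ y).1 z * ad (D.u z y) ((F₂ (y⁻¹ * x)).1 (z * y))) ◁ _)) ◁ _ = _
  rw [smul_rmul]
  congr 1
  refine emb_injective ?_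
  simp only [emb_rmul, emb_mul, emb_ad, Submonoid.coe_mul, mul_assoc, mul_inv_cancel_left,
    inv_mul_coe, mul_one, inv_mul_cancel_coe]

end Induced

/-! ### Transport of structure and extension to completions -/

section Transport

/-- The ⋆-algebra axioms can be checked after applying an injective linear map `T` that respects the
operations and satisfies `T⁻¹(V') = V`. -/
theorem IsStarAlgebra.comap {W W' : Type*} [AddCommGroup W] [Module ℂ W] [AddCommGroup W']
    [Module ℂ W'] {V : Submodule ℂ W} {V' : Submodule ℂ W'} {mul : W → W → W}
    {mul' : W' → W' → W'} {inv : W → W} {inv' : W' → W'} (h : IsStarAlgebra V' mul' inv')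
    (T : W →ₗ[ℂ] W') (hT : Function.Injective T) (hV : ∀ a, T a ∈ V' ↔ a ∈ V)
    (hmul : ∀ a ∈ V, ∀ b ∈ V, T (mul a b) = mul' (T a) (T b))
    (hinv : ∀ a, T (inv a) = inv' (T a)) : IsStarAlgebra V mul inv where
  mul_mem a ha b hb := (hV _).1 (by
    rw [hmul a ha b hb]
    exact h.mul_mem _ ((hV a).2 ha) _ ((hV b).2 hb))
  add_mul a ha b hb c hc := hT (by
    rw [hmul _ (V.add_mem ha hb) c hc, map_add, map_add, hmul a ha c hc, hmul b hb c hc,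
      h.add_mul _ ((hV a).2 ha) _ ((hV b).2 hb) _ ((hV c).2 hc)])
  mul_add a ha b hb c hc := hT (by
    rw [hmul a ha _ (V.add_mem hb hc), map_add, map_add, hmul a ha b hb, hmul a ha c hc,
      h.mul_add _ ((hV a).2 ha) _ ((hV b).2 hb) _ ((hV c).2 hc)])
  smul_mul t a ha b hb := hT (by
    rw [hmul _ (V.smul_mem t ha) b hb, map_smul, map_smul, hmul a ha b hb,
      h.smul_mul t _ ((hV a).2 ha) _ ((hV b).2 hb)])
  mul_smul t a ha b hb := hT (by
    rw [hmul a ha _ (V.smul_mem t hb), map_smul, map_smul, hmul a ha b hb,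
      h.mul_smul t _ ((hV a).2 ha) _ ((hV b).2 hb)])
  inv_mem a ha := (hV _).1 (by
    rw [hinv]
    exact h.inv_mem _ ((hV a).2 ha))
  inv_inv a ha := hT (by rw [hinv, hinv, h.inv_inv _ ((hV a).2 ha)])
  inv_add a ha b hb := hT (by
    rw [hinv, map_add, map_add, hinv, hinv, h.inv_add _ ((hV a).2 ha) _ ((hV b).2 hb)])
  inv_smul t a ha := hT (by rw [hinv, map_smul, map_smul, hinv, h.inv_smul t _ ((hV a).2 ha)])
  inv_mul a ha b hb := hT (by
    have hi {c : W} (hc : c ∈ V) : inv c ∈ V := (hV _).1 (by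
      rw [hinv]
      exact h.inv_mem _ ((hV c).2 hc))
    rw [hinv, hmul a ha b hb, h.inv_mul _ ((hV a).2 ha) _ ((hV b).2 hb),
      hmul _ (hi hb) _ (hi ha), hinv, hinv])

/-- An isometric isomorphism `Φ` of ⋆-algebras extends to the completions, and the extension
preserves the partially defined product and adjoint. The first algebra consists of functions with
values in a C⋆-algebra, which fixes its additive structure to be that of `CompactlySupported`. -/
theorem exists_extension_of_isometric {S B W' : Type*} [NonUnitalCStarAlgebra B]
    [AddCommGroup W'] [Module ℂ W'] {V : Submodule ℂ (S → B)} {V' : Submodule ℂ W'}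
    {mul : (S → B) → (S → B) → (S → B)} {mul' : W' → W' → W'}
    {inv : (S → B) → (S → B)} {inv' : W' → W'} {nrm : (S → B) → ℝ≥0∞} {nrm' : W' → ℝ≥0∞}
    (Φ : V ≃ₗ[ℂ] V')
    (hmul : ∀ a b c : V, (c : S → B) = mul a b ↔ (Φ c : W') = mul' (Φ a) (Φ b))
    (hinv : ∀ a b : V, (b : S → B) = inv a ↔ (Φ b : W') = inv' (Φ a))
    (hnrm : ∀ a, nrm' (Φ a) = nrm a)
    {X : Type*} [NormedAddCommGroup X] [NormedSpace ℂ X] {i : V →ₗ[ℂ] X}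
    {Y : Type*} [NormedAddCommGroup Y] [NormedSpace ℂ Y] {j : V' →ₗ[ℂ] Y}
    (hi : IsCompletion nrm i) (hj : IsCompletion nrm' j) :
    ∃ Ψ : X ≃ₗᵢ[ℂ] Y, (∀ a, Ψ (i a) = j (Φ a)) ∧
      (∀ a b c, IsLimitProduct mul i a b c ↔ IsLimitProduct mul' j (Ψ a) (Ψ b) (Ψ c)) ∧
      ∀ a b, IsLimitAdjoint inv i a b ↔ IsLimitAdjoint inv' j (Ψ a) (Ψ b) := by
  have := hi.complete
  have := hj.complete
  have hn (a : V) : ‖j (Φ a)‖ = ‖i a‖ := by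
    rw [← toReal_enorm, ← toReal_enorm, hi.enorm_eq, hj.enorm_eq, hnrm]
  let Ψ : X ≃ₗᵢ[ℂ] Y := Φ.extendOfIsometry i j hi.dense hj.dense hn
  have hΨ (a : V) : Ψ (i a) = j (Φ a) := Φ.extendOfIsometry_eq i j hi.dense hj.dense hn a
  refine ⟨Ψ, hΨ, fun a b c => ?_, fun a b => ?_⟩
  · let e : X × X × X ≃ₜ Y × Y × Y :=
      Ψ.toHomeomorph.prodCongr (Ψ.toHomeomorph.prodCongr Ψ.toHomeomorph)
    have he : (Ψ a, Ψ b, Ψ c) = e (a, b, c) := rfl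
    rw [IsLimitProduct, IsLimitProduct, he, ← Set.mem_preimage (f := e), e.preimage_closure]
    have hs : {t : X × X × X | ∃ a' b' c' : V, (c' : S → B) = mul a' b' ∧ t = (i a', i b', i c')} =
        e ⁻¹' {t | ∃ a' b' c' : V', (c' : W') = mul' a' b' ∧ t = (j a', j b', j c')} := by
      ext t
      constructor
      · rintro ⟨a', b', c', h, rfl⟩
        refine ⟨Φ a', Φ b', Φ c', (hmul _ _ _).1 h, ?_⟩
        rw [← hΨ, ← hΨ, ← hΨ]
        rfl
      · rintro ⟨a', b', c', h, ht⟩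
        refine ⟨Φ.symm a', Φ.symm b', Φ.symm c', (hmul _ _ _).2 (by simpa using h),
          e.injective (ht.trans ?_)⟩
        change _ = (Ψ _, Ψ _, Ψ _)
        simp only [hΨ, LinearEquiv.apply_symm_apply]
    rw [hs]
  · let e : X × X ≃ₜ Y × Y := Ψ.toHomeomorph.prodCongr Ψ.toHomeomorph
    have he : (Ψ a, Ψ b) = e (a, b) := rfl
    rw [IsLimitAdjoint, IsLimitAdjoint, he, ← Set.mem_preimage (f := e), e.preimage_closure]
    have hs : {t : X × X | ∃ a' b' : V, (b' : S → B) = inv a' ∧ t = (i a', i b')} =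
        e ⁻¹' {t | ∃ a' b' : V', (b' : W') = inv' a' ∧ t = (j a', j b')} := by
      ext t
      constructor
      · rintro ⟨a', b', h, rfl⟩
        refine ⟨Φ a', Φ b', (hinv _ _).1 h, ?_⟩
        rw [← hΨ, ← hΨ]
        rfl
      · rintro ⟨a', b', h, ht⟩
        refine ⟨Φ.symm a', Φ.symm b', (hinv _ _).2 (by simpa using h),
          e.injective (ht.trans ?_)⟩
        change _ = (Ψ _, Ψ _)
        simp only [hΨ, LinearEquiv.apply_symm_apply]
    rw [hs]

variable {G : Type*} [Group G] [TopologicalSpace G] [IsTopologicalGroup G] [T2Space G]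
  {φ : Tricharacter G} {N : Subgroup G} {A : Type*} [NonUnitalCStarAlgebra A]
  {D : TwistedSystem φ N A}

variable (D) in
/-- The ⋆-isomorphism `F ↦ ((z, w) ↦ F(z⁻¹w)(z) u(z, z⁻¹w))` from `C_c(G, B)` onto the kernels. -/
def kerEquiv : CompactlySupported G (induced D) ≃ₗ[ℂ] Kernels D :=
  LinearEquiv.ofBijective ((toKer D).restrict fun _ hF => toKer_mem hF)
    ⟨fun _ _ h => Subtype.ext (toKer_injective (congrArg Subtype.val h)), fun K => by
      obtain ⟨F, hF, h⟩ := exists_toKer_eq K.2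
      exact ⟨⟨F, hF⟩, Subtype.ext h⟩⟩

theorem coe_kerEquiv (F : CompactlySupported G (induced D)) :
    (kerEquiv D F : G → G → A) = toKer D F := rfl

variable [MeasurableSpace G] [BorelSpace G] {μ : Measure G} [LocallyCompactSpace G]
  [μ.IsHaarMeasure]

theorem isStarAlgebra_compactlySupported :
    IsStarAlgebra (CompactlySupported G (induced D)) (conv μ (beta D) (v D))
      (convStar (beta D) (v D)) :=
  (isStarAlgebra_kernels (μ := μ) (D := D)).comap (toKer D) toKer_injective
    (fun _ => toKer_mem_iff) (fun _ ha _ hb => toKer_conv ha hb) toKer_convStar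

/-- Evaluating the norm of `(F* * F)(1) ∈ u-ind_N^G(A)` as a supremum over `z` gives the values of
`Φ(F)* ⋆ Φ(F)` at `(z, z)`, up to unitaries. -/
theorem convL2_eq_kerL2 {F : G → induced D} (hF : F ∈ CompactlySupported G (induced D)) :
    convL2 μ (beta D) (v D) F = kerL2 μ φ (toKer D F) := by
  have hS : convStar (beta D) (v D) F ∈ CompactlySupported G (induced D) :=
    (isStarAlgebra_compactlySupported (μ := μ)).inv_mem F hF
  have h (f : induced D) : ‖f‖ₑ = ⨆ z, ‖f.1 z‖ₑ :=
    BoundedContinuousFunction.enorm_eq_iSup_enorm f.1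
  have hp : (0 : ℝ) < 1 / 2 := by norm_num
  rw [convL2, kerL2, h]
  refine ((ENNReal.orderIsoRpow (1 / 2) hp).map_iSup _).trans (iSup_congr fun z => ?_)
  rw [ENNReal.orderIsoRpow_apply, ← toKer_convStar, ← toKer_conv hS hF, toKer_apply,
    ← ofReal_norm, ← ofReal_norm, norm_unitary_rmul, inv_mul_cancel]

theorem convNorm_eq_kerNorm {F : G → induced D} (hF : F ∈ CompactlySupported G (induced D)) :
    convNorm μ (beta D) (v D) F = kerNorm μ D (toKer D F) := by
  have hm {F' : G → induced D} (hF' : F' ∈ CompactlySupported G (induced D)) :=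
    (isStarAlgebra_compactlySupported (μ := μ)).mul_mem F hF F' hF'
  refine le_antisymm (iSup₂_le fun F' hF' => ?_) (kerNorm_le fun K hK hK1 => ?_)
  · rw [convL2_eq_kerL2 (hm hF'.1), toKer_conv hF hF'.1]
    refine kerL2_mul_le_kerNorm _ (toKer_mem hF'.1) ?_
    rw [← convL2_eq_kerL2 hF'.1]
    exact hF'.2
  · obtain ⟨F', hF', rfl⟩ := exists_toKer_eq hK
    rw [← toKer_conv hF hF', ← convL2_eq_kerL2 (hm hF')]
    refine le_iSup₂ (f := fun (F' : G → induced D)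
      (_ : F' ∈ {F' ∈ CompactlySupported G (induced D) | convL2 μ (beta D) (v D) F' ≤ 1}) =>
      convL2 μ (beta D) (v D) (conv μ (beta D) (v D) F F'))
      F' ⟨hF', ?_⟩
    rwa [convL2_eq_kerL2 hF']

end Transport

end TwistedInduction
end

open TwistedInduction in
theorem theorem8p1 {G : Type*} [Group G] [TopologicalSpace G] [IsTopologicalGroup G] [T2Space G]
    [LocallyCompactSpace G] [SecondCountableTopology G] [MeasurableSpace G] [BorelSpace G]
    (μ : Measure G) [μ.IsHaarMeasure] [μ.IsMulRightInvariant]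
    (N : Subgroup G) (hN : IsClosed (N : Set G)) (φ : Tricharacter G)
    {A : Type*} [NonUnitalCStarAlgebra A] (D : TwistedSystem φ N A) :
    -- the compactly supported functions and the kernels are ⋆-algebras
    IsStarAlgebra (CompactlySupported G (induced D)) (conv μ (beta D) (v D))
      (convStar (beta D) (v D)) ∧
    IsStarAlgebra (Kernels D) (kerMul μ φ) kerStar ∧
    -- the left regular representation defines a norm, and the involution is isometric for it
    (∃ p : Seminorm ℂ (CompactlySupported G (induced D)),
      (∀ F, ENNReal.ofReal (p F) = convNorm μ (beta D) (v D) F) ∧ ∀ F, p F = 0 → F = 0) ∧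
    (∀ F ∈ CompactlySupported G (induced D), convNorm μ (beta D) (v D) (convStar (beta D) (v D) F) =
      convNorm μ (beta D) (v D) F) ∧
    -- there is an isometric ⋆-isomorphism
    ∃ Φ : CompactlySupported G (induced D) ≃ₗ[ℂ] Kernels D,
      (∀ F₁ F₂ F : CompactlySupported G (induced D),
        (F : G → induced D) = conv μ (beta D) (v D) F₁ F₂ →
          (Φ F : G → G → A) = kerMul μ φ (Φ F₁) (Φ F₂)) ∧
      (∀ F F' : CompactlySupported G (induced D),
        (F' : G → induced D) = convStar (beta D) (v D) F →
          (Φ F' : G → G → A) = kerStar (Φ F)) ∧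
      (∀ F, kerNorm μ D (Φ F) = convNorm μ (beta D) (v D) F) ∧
      -- and it extends to the completions
      ∀ (X : Type*) [NormedAddCommGroup X] [NormedSpace ℂ X]
        (i : CompactlySupported G (induced D) →ₗ[ℂ] X)
        (Y : Type*) [NormedAddCommGroup Y] [NormedSpace ℂ Y] (j : Kernels D →ₗ[ℂ] Y),
        IsCompletion (convNorm μ (beta D) (v D)) i → IsCompletion (kerNorm μ D) j →
        ∃ Ψ : X ≃ₗᵢ[ℂ] Y, (∀ F, Ψ (i F) = j (Φ F)) ∧
          (∀ a b c, IsLimitProduct (conv μ (beta D) (v D)) i a b c ↔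
            IsLimitProduct (kerMul μ φ) j (Ψ a) (Ψ b) (Ψ c)) ∧
          ∀ a b, IsLimitAdjoint (convStar (beta D) (v D)) i a b ↔
            IsLimitAdjoint kerStar j (Ψ a) (Ψ b) := by
  have hA := isStarAlgebra_compactlySupported (D := D) (μ := μ)
  have hmem (F : CompactlySupported G (induced D)) : toKer D F ∈ Kernels D := toKer_mem F.2
  have hfin (F : CompactlySupported G (induced D)) : kerNorm μ D (toKer D F) ≠ ⊤ :=
    kerNorm_ne_top (hmem F)
  have hmul (a b c : CompactlySupported G (induced D)) :
      (c : G → induced D) = conv μ (beta D) (v D) a b ↔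
        (kerEquiv D c : G → G → A) = kerMul μ φ (kerEquiv D a) (kerEquiv D b) := by
    rw [coe_kerEquiv, coe_kerEquiv, coe_kerEquiv, ← toKer_conv a.2 b.2, toKer_injective.eq_iff]
  have hinv (a b : CompactlySupported G (induced D)) :
      (b : G → induced D) = convStar (beta D) (v D) a ↔
        (kerEquiv D b : G → G → A) = kerStar (kerEquiv D a) := by
    rw [coe_kerEquiv, coe_kerEquiv, ← toKer_convStar, toKer_injective.eq_iff]
  have hnrm (a : CompactlySupported G (induced D)) :
      kerNorm μ D (kerEquiv D a) = convNorm μ (beta D) (v D) a := by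
    rw [coe_kerEquiv, convNorm_eq_kerNorm a.2]
  refine ⟨hA, isStarAlgebra_kernels, ⟨Seminorm.of
    (fun F => (kerNorm μ D (toKer D F)).toReal) (fun F F' => ?_) (fun c F => ?_),
    fun F => ?_, fun F hF => ?_⟩, fun F hF => ?_, kerEquiv D, fun a b c => (hmul a b c).1,
    fun a b => (hinv a b).1, hnrm, fun X _ _ i Y _ _ j hi hj => ?_⟩
  · rw [← ENNReal.toReal_add (hfin F) (hfin F')]
    refine ENNReal.toReal_mono (ENNReal.add_ne_top.2 ⟨hfin F, hfin F'⟩) ?_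
    rw [Submodule.coe_add, map_add]
    exact kerNorm_add_le (hmem F) (hmem F')
  · rw [Submodule.coe_smul, map_smul, kerNorm_smul c (hmem F), ENNReal.toReal_mul, toReal_enorm]
  · rw [convNorm_eq_kerNorm F.2]
    exact ENNReal.ofReal_toReal (hfin F)
  · have h0 : kerNorm μ D (toKer D F) = 0 :=
      ((ENNReal.toReal_eq_zero_iff _).1 hF).resolve_right (hfin F)
    refine Subtype.ext (toKer_injective ?_)
    rw [eq_zero_of_kerNorm_eq_zero (hmem F) h0]
    exact (map_zero (toKer D)).symm
  · rw [convNorm_eq_kerNorm hF, convNorm_eq_kerNorm (hA.inv_mem F hF), toKer_convStar,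
      kerNorm_star (toKer_mem hF)]
  · exact exists_extension_of_isometric (kerEquiv D) hmul hinv hnrm hi hj
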